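/- Conventions. A function $F:[0,\infty)^4\to[0,\infty)$ is permissible if it is nondecreasing in each variable and $x\,l_y+y\,l_x\le F(x,y,l_x,l_y)$ for all $x,y,l_x,l_y\ge 0$. For a nonzero unital C*-algebra $\mathfrak A$, let $\mathfrak{sa}(\mathfrak A)$ be its real subspace of self-adjoint elements and $\mathscr S(\mathfrak A)$ its state space. An $F$-quasi-Leibniz quantum compact metric space is a pair $(\mathfrak A,L)$ of such an algebra and a seminorm $L$ on a dense real subspace $\mathrm{dom}(L)$ of $\mathfrak{sa}(\mathfrak A)$ that is closed under $a\circ b=\frac12(ab+ba)$ and $\{a,b\}=\frac1{2i}(ab-ba)$ (put $L=\infty$ off $\mathrm{dom}(L)$), such that: (1) $\{a: L(a)=0\}=\mathbb R 1_{\mathfrak A}$; (2) $\{a\in\mathfrak{sa}(\mathfrak A): L(a)\le 1\}$ is norm closed; (3) $\mathsf{mk}_L(\varphi,\psi)=\sup\{|\varphi(a)-\psi(a)|: L(a)\le1\}$ is a metric on $\mathscr S(\mathfrak A)$ that induces the weak* topology; (4) $L(a\circ b)$ and $L(\{a,b\})$ are at most $F(\|a\|,\|b\|,L(a),L(b))$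 for all $a,b\in\mathrm{dom}(L)$. An $F$-tunnel $(\mathfrak D,L_{\mathfrak D},\pi_1,\pi_2)$ from $(\mathfrak A_1,L_1)$ to $(\mathfrak A_2,L_2)$ is an $F$-quasi-Leibniz quantum compact metric space $(\mathfrak D,L_{\mathfrak D})$ with surjective *-homomorphisms $\pi_j:\mathfrak D\to\mathfrak A_j$ such that $L_j(a)=\inf\{L_{\mathfrak D}(d): d\in\mathfrak{sa}(\mathfrak D),\ \pi_j(d)=a\}$ for all $a\in\mathfrak{sa}(\mathfrak A_j)$, $j=1,2$. Its extent is the maximum over $j\in\{1,2\}$ of the Hausdorff distance, for $\mathsf{mk}_{L_{\mathfrak D}}$, between $\mathscr S(\mathfrak D)$ and $\{\varphi\circ\pi_j:\varphi\in\mathscr S(\mathfrak A_j)\}$. Proposition. Let $F$ be permissible, let $(\mathfrak A,L_{\mathfrak A})$ and $(\mathfrak B,L_{\mathfrak B})$ be $F$-quasi-Leibniz quantum compact metric spaces with $\mathfrak A,\mathfrak B\neq 0$, and let $D=\max\{\mathrm{diam}(\mathscr S(\mathfrak A),\mathsf{mk}_{L_{\mathfrak A}}),\mathrm{diam}(\mathscr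 S(\mathfrak B),\mathsf{mk}_{L_{\mathfrak B}})\}$. Then $D<\infty$, and for every $\varepsilon\ge0$ with $D+\varepsilon>0$ there is an $F$-tunnel from $(\mathfrak A,L_{\mathfrak A})$ to $(\mathfrak B,L_{\mathfrak B})$ of extent at most $D+\varepsilon$. More precisely, let $\mathscr H$ be any separable infinite-dimensional complex Hilbert space. Then $\mathfrak A$ and $\mathfrak B$ both have faithful unital representations on $\mathscr H$, and for all faithful unital representations $\pi_{\mathfrak A}$, $\pi_{\mathfrak B}$ of them on $\mathscr H$ and every $\varepsilon\ge0$ with $D+\varepsilon>0$, the algebra $\mathfrak A\oplus\mathfrak B$ with $$L(a,b)=\max\Big\{L_{\mathfrak A}(a),\,L_{\mathfrak B}(b),\,\tfrac1{D+\varepsilon}\|\pi_{\mathfrak A}(a)-\pi_{\mathfrak B}(b)\|\Big\}$$ and the two coordinate projections is an $F$-tunnel from $(\mathfrak A,L_{\mathfrak A})$ to $(\mathfrak B,L_{\mathfrak B})$ of extent at most $D+\varepsilon$. -/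

import Mathlib

open scoped NNReal ENNReal ComplexOrder

universe u v w

namespace QuantumMetric

/-- A state of a unital C*-algebra: a positive linear functional mapping `1` to `1`. -/
def IsState {A : Type*} [CStarAlgebra A] (φ : WeakDual ℂ A) : Prop :=
  φ 1 = 1 ∧ ∀ a : A, 0 ≤ φ (star a * a)

/-- The state space, with the (subspace) weak* topology. -/
abbrev StateSpace (A : Type*) [CStarAlgebra A] : Type _ :=
  {φ : WeakDual ℂ A // IsState φ}

/-- The Jordan product `(ab + ba) / 2` of two self-adjoint elements. -/
noncomputable def jordanProd {A : Type*} [CStarAlgebra A] (a b : selfAdjoint A) : selfAdjoint A :=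
  ⟨(1 / 2 : ℂ) • ((a : A) * b + b * a), by
    rw [selfAdjoint.mem_iff, star_smul, star_add, star_mul, star_mul,
      selfAdjoint.star_val_eq, selfAdjoint.star_val_eq, add_comm]
    simp⟩

/-- The Lie product `(ab - ba) / (2i)` of two self-adjoint elements. -/
noncomputable def lieProd {A : Type*} [CStarAlgebra A] (a b : selfAdjoint A) : selfAdjoint A :=
  ⟨(1 / (2 * Complex.I) : ℂ) • ((a : A) * b - b * a), by
    rw [selfAdjoint.mem_iff, star_smul, star_sub, star_mul, star_mul,
      selfAdjoint.star_val_eq, selfAdjoint.star_val_eq, ← neg_sub, smul_neg, ← neg_smul]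
    congr 1
    simp⟩

/-- A seminorm defined on a real subspace of the self-adjoint part of `A`, extended by the value
`∞` outside of that subspace (with `0 * ∞ = 0`). -/
structure PartialSeminorm (A : Type*) [CStarAlgebra A] where
  toFun : selfAdjoint A → ℝ≥0∞
  smul' : ∀ (r : ℝ) (a : selfAdjoint A), toFun (r • a) = ‖r‖ₑ * toFun a
  add_le' : ∀ a b : selfAdjoint A, toFun (a + b) ≤ toFun a + toFun b

instance {A : Type*} [CStarAlgebra A] :
    CoeFun (PartialSeminorm A) (fun _ => selfAdjoint A → ℝ≥0∞) := ⟨PartialSeminorm.toFun⟩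

/-- The domain of a partially defined seminorm: the real subspace where it is finite. -/
def PartialSeminorm.dom {A : Type*} [CStarAlgebra A] (L : PartialSeminorm A) :
    Submodule ℝ (selfAdjoint A) where
  carrier := {a | L a < ∞}
  zero_mem' := by
    have h := L.smul' 0 0
    simp only [smul_zero, enorm_zero, zero_mul] at h
    simp [h]
  add_mem' := fun {a b} ha hb =>
    lt_of_le_of_lt (L.add_le' a b) (ENNReal.add_lt_top.2 ⟨ha, hb⟩)
  smul_mem' := fun r a ha => by
    simp only [Set.mem_ofPred_eq, L.smul'] at ha ⊢
    exact ENNReal.mul_lt_top enorm_lt_top ha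

/-- The Monge-Kantorovich distance between states:
`sup {|φ(a) - ψ(a)| : L(a) ≤ 1}`, a priori with values in `[0, ∞]`. -/
noncomputable def mkDist {A : Type*} [CStarAlgebra A] (L : PartialSeminorm A)
    (φ ψ : StateSpace A) : ℝ≥0∞ :=
  ⨆ (a : selfAdjoint A) (_ : L a ≤ 1), ‖φ.1 (a : A) - ψ.1 (a : A)‖ₑ

/-- The Monge-Kantorovich distance as an extended pseudo-metric, with the topology it induces. -/
@[reducible] noncomputable def mkMetric {A : Type*} [CStarAlgebra A] (L : PartialSeminorm A) :
    PseudoEMetricSpace (StateSpace A) where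
  edist := mkDist L
  edist_self φ := by simp [mkDist]
  edist_comm φ ψ := by
    simp only [mkDist]
    refine iSup_congr fun a => iSup_congr fun _ => ?_
    rw [← enorm_neg, neg_sub]
  edist_triangle φ ψ θ := by
    refine iSup₂_le fun a ha => ?_
    rw [← sub_add_sub_cancel (φ.1 (a : A)) (ψ.1 (a : A)) (θ.1 (a : A))]
    refine (enorm_add_le _ _).trans (add_le_add ?_ ?_)
    · exact le_iSup₂_of_le a ha le_rfl
    · exact le_iSup₂_of_le a ha le_rfl

/-- The diameter of the state space for the Monge-Kantorovich metric. -/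
noncomputable def stateDiam {A : Type*} [CStarAlgebra A] (L : PartialSeminorm A) : ℝ≥0∞ :=
  @Metric.ediam (StateSpace A) (mkMetric L) Set.univ

/-- The Hausdorff distance on sets of states for the Monge-Kantorovich metric. -/
noncomputable def mkHausdorff {A : Type*} [CStarAlgebra A] (L : PartialSeminorm A)
    (s t : Set (StateSpace A)) : ℝ≥0∞ :=
  @Metric.hausdorffEDist (StateSpace A) (mkMetric L) s t

/-- Permissible functions `F : [0, ∞)⁴ → [0, ∞)`. -/
structure IsPermissible (F : ℝ≥0 → ℝ≥0 → ℝ≥0 → ℝ≥0 → ℝ≥0) : Prop where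
  mono : ∀ x₁ x₂ x₃ x₄ y₁ y₂ y₃ y₄ : ℝ≥0, x₁ ≤ y₁ → x₂ ≤ y₂ → x₃ ≤ y₃ → x₄ ≤ y₄ →
    F x₁ x₂ x₃ x₄ ≤ F y₁ y₂ y₃ y₄
  le : ∀ x y lx ly : ℝ≥0, x * ly + y * lx ≤ F x y lx ly

/-- The `F`-quasi-Leibniz property on the domain of `L`. -/
def IsQuasiLeibniz {A : Type*} [CStarAlgebra A] (F : ℝ≥0 → ℝ≥0 → ℝ≥0 → ℝ≥0 → ℝ≥0)
    (L : PartialSeminorm A) : Prop :=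
  ∀ a ∈ L.dom, ∀ b ∈ L.dom,
    L (jordanProd a b) ≤ F ‖(a : A)‖₊ ‖(b : A)‖₊ (L a).toNNReal (L b).toNNReal ∧
    L (lieProd a b) ≤ F ‖(a : A)‖₊ ‖(b : A)‖₊ (L a).toNNReal (L b).toNNReal

/-- `(A, L)` is an `F`-quasi-Leibniz quantum compact metric space. -/
structure IsQuantumCompactMetricSpace {A : Type*} [CStarAlgebra A]
    (F : ℝ≥0 → ℝ≥0 → ℝ≥0 → ℝ≥0 → ℝ≥0) (L : PartialSeminorm A) : Prop where
  dense_dom : Dense (L.dom : Set (selfAdjoint A))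
  jordan_mem : ∀ a ∈ L.dom, ∀ b ∈ L.dom, jordanProd a b ∈ L.dom
  lie_mem : ∀ a ∈ L.dom, ∀ b ∈ L.dom, lieProd a b ∈ L.dom
  ker : {a : selfAdjoint A | L a = 0} = Set.range fun r : ℝ => r • (1 : selfAdjoint A)
  closed : IsClosed {a : selfAdjoint A | L a ≤ 1}
  mk_finite : ∀ φ ψ : StateSpace A, mkDist L φ ψ < ∞
  mk_topology : (mkMetric L).toUniformSpace.toTopologicalSpace =
    (inferInstance : TopologicalSpace (StateSpace A))
  quasiLeibniz : IsQuasiLeibniz F L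

/-- The restriction of a unital *-homomorphism to the self-adjoint parts. -/
def saMap {D A : Type*} [CStarAlgebra D] [CStarAlgebra A] (π : D →⋆ₐ[ℂ] A)
    (d : selfAdjoint D) : selfAdjoint A :=
  ⟨π d, by rw [selfAdjoint.mem_iff, ← map_star, selfAdjoint.star_val_eq]⟩

/-- The dual map `φ ↦ φ ∘ π` on state spaces. -/
noncomputable def dualMap {D A : Type*} [CStarAlgebra D] [CStarAlgebra A] (π : D →⋆ₐ[ℂ] A)
    (φ : StateSpace A) : StateSpace D :=
  ⟨StrongDual.toWeakDual ((WeakDual.toStrongDual φ.1).comp ⟨(π : D →ₗ[ℂ] A),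
    AddMonoidHomClass.continuous_of_bound π 1
      (by simpa using NonUnitalStarAlgHom.norm_apply_le π)⟩), by
    refine ⟨?_, fun d => ?_⟩
    · change φ.1 (π 1) = 1
      rw [map_one]
      exact φ.2.1
    · have h := φ.2.2 (π d)
      rw [← map_star, ← map_mul] at h
      exact h⟩

/-- `(D, L, π₁, π₂)` is an `F`-tunnel from `(A, LA)` to `(B, LB)`: it is an `F`-quasi-Leibniz
quantum compact metric space, `π₁` and `π₂` are *-epimorphisms, and `LA` and `LB` are the quotients
of `L` along them. (A surjective *-homomorphism between unital algebras is unital.) -/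
structure IsTunnel {A B D : Type*} [CStarAlgebra A] [CStarAlgebra B] [CStarAlgebra D]
    (F : ℝ≥0 → ℝ≥0 → ℝ≥0 → ℝ≥0 → ℝ≥0) (LA : PartialSeminorm A) (LB : PartialSeminorm B)
    (L : PartialSeminorm D) (π₁ : D →⋆ₐ[ℂ] A) (π₂ : D →⋆ₐ[ℂ] B) : Prop where
  space : IsQuantumCompactMetricSpace F L
  surj₁ : Function.Surjective π₁
  surj₂ : Function.Surjective π₂
  quotient₁ : ∀ a : selfAdjoint A, LA a = ⨅ (d : selfAdjoint D) (_ : saMap π₁ d = a), L d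
  quotient₂ : ∀ b : selfAdjoint B, LB b = ⨅ (d : selfAdjoint D) (_ : saMap π₂ d = b), L d

/-- The extent of a tunnel `(D, L, π₁, π₂)`. -/
noncomputable def extent {A B D : Type*} [CStarAlgebra A] [CStarAlgebra B] [CStarAlgebra D]
    (L : PartialSeminorm D) (π₁ : D →⋆ₐ[ℂ] A) (π₂ : D →⋆ₐ[ℂ] B) : ℝ≥0∞ :=
  max (mkHausdorff L Set.univ (Set.range (dualMap π₁)))
    (mkHausdorff L Set.univ (Set.range (dualMap π₂)))

/-- The seminorm `(a, b) ↦ max {LA(a), LB(b), ‖πA(a) - πB(b)‖ / r}` on `A ⊕ B`, for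
representations `πA` and `πB` on a common Hilbert space. -/
noncomputable def glue {A B : Type*} [CStarAlgebra A] [CStarAlgebra B]
    {H : Type*} [NormedAddCommGroup H] [InnerProductSpace ℂ H] [CompleteSpace H]
    (LA : PartialSeminorm A) (LB : PartialSeminorm B)
    (πA : A →⋆ₐ[ℂ] (H →L[ℂ] H)) (πB : B →⋆ₐ[ℂ] (H →L[ℂ] H)) (r : ℝ≥0∞) :
    PartialSeminorm (A × B) where
  toFun x := max (max (LA (saMap (StarAlgHom.fst ℂ A B) x)) (LB (saMap (StarAlgHom.snd ℂ A B) x)))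
    (‖πA (x : A × B).1 - πB (x : A × B).2‖ₑ / r)
  smul' c x := by
    have h1 : saMap (StarAlgHom.fst ℂ A B) (c • x) = c • saMap (StarAlgHom.fst ℂ A B) x := rfl
    have h2 : saMap (StarAlgHom.snd ℂ A B) (c • x) = c • saMap (StarAlgHom.snd ℂ A B) x := rfl
    have h3 : πA ((c • x : selfAdjoint (A × B)) : A × B).1
        - πB ((c • x : selfAdjoint (A × B)) : A × B).2
        = (c : ℂ) • (πA (x : A × B).1 - πB (x : A × B).2) := by
      have e1 : ((c • x : selfAdjoint (A × B)) : A × B).1 = (c : ℂ) • (x : A × B).1 := by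
        rw [Complex.coe_smul]; rfl
      have e2 : ((c • x : selfAdjoint (A × B)) : A × B).2 = (c : ℂ) • (x : A × B).2 := by
        rw [Complex.coe_smul]; rfl
      rw [e1, e2, map_smul, map_smul, smul_sub]
    have h4 : ‖(c : ℂ)‖ₑ = ‖c‖ₑ := by
      rw [← ofReal_norm, ← ofReal_norm, Complex.norm_real]
    rw [h1, h2, h3, LA.smul', LB.smul', enorm_smul, h4, mul_div_assoc, mul_max, mul_max]
  add_le' x y := by
    have h1 : saMap (StarAlgHom.fst ℂ A B) (x + y)
        = saMap (StarAlgHom.fst ℂ A B) x + saMap (StarAlgHom.fst ℂ A B) y := rfl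
    have h2 : saMap (StarAlgHom.snd ℂ A B) (x + y)
        = saMap (StarAlgHom.snd ℂ A B) x + saMap (StarAlgHom.snd ℂ A B) y := rfl
    have h3 : πA ((x + y : selfAdjoint (A × B)) : A × B).1
        - πB ((x + y : selfAdjoint (A × B)) : A × B).2
        = (πA (x : A × B).1 - πB (x : A × B).2) + (πA (y : A × B).1 - πB (y : A × B).2) := by
      have e1 : ((x + y : selfAdjoint (A × B)) : A × B).1 = (x : A × B).1 + (y : A × B).1 := rfl
      have e2 : ((x + y : selfAdjoint (A × B)) : A × B).2 = (x : A × B).2 + (y : A × B).2 := rfl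
      rw [e1, e2, map_add, map_add, add_sub_add_comm]
    rw [h1, h2, h3]
    refine max_le (max_le ?_ ?_) ?_
    · exact (LA.add_le' _ _).trans
        (add_le_add (le_max_of_le_left (le_max_left _ _)) (le_max_of_le_left (le_max_left _ _)))
    · exact (LB.add_le' _ _).trans
        (add_le_add (le_max_of_le_left (le_max_right _ _)) (le_max_of_le_left (le_max_right _ _)))
    · refine (ENNReal.div_le_div_right (enorm_add_le _ _) r).trans ?_
      rw [ENNReal.add_div]
      exact add_le_add (le_max_right _ _) (le_max_right _ _)

end QuantumMetric

open QuantumMetric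

/-! Put `r = D + ε`. A finite-diameter estimate makes scalars good partners. For any state `μ` and
any `a` with `L a < ∞`, states norm self-adjoint elements, so `‖a - μ(a)1‖ ≤ L(a) · diam ≤ L(a) r`.
Hence `(a, μ(a)1)` lifts `a` to the direct sum without increasing the seminorm. The same works from
the other side, which gives the quotient conditions; this is the only place where `r ≥ D` matters
(`glue_isTunnel`).

The extent bound comes from Hahn–Banach. A state of `A × B` is the restriction of a state `Ω` of
`B(H) × B(H)` along `πA × πB`, and `a ↦ Ω(πA a, πA a)` is a state of `A` differing from it on `(a,
b)` by at most `‖πA a - πB b‖ ≤ r` (`glue_extent_le`).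

That the glued seminorm metrizes the weak* topology follows from a total boundedness criterion:
`IsQuantumCompactMetricSpace.totallyBounded` in one direction, `mkDist_lt_top_of_totallyBounded` and
`mk_topology_of_totallyBounded` in the other. The Leibniz bound for the bridge term is the
inequality `x ly + y lx ≤ F`.

Faithful representations on `H` exist because the state space is compact and metrizable: the Hilbert
sum of the GNS representations of a dense sequence of states is faithful, separable and
infinite-dimensional. -/

namespace QuantumMetric

/-! ### States of a unital C*-algebra: characterization, extension, compactness. -/

section States

variable {A : Type*} [CStarAlgebra A]

attribute [local instance] CStarAlgebra.spectralOrder CStarAlgebra.spectralOrderedRing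

lemma StateSpace.map_one (φ : StateSpace A) : φ.1 1 = 1 := φ.2.1

lemma StateSpace.map_nonneg (φ : StateSpace A) {a : A} (ha : 0 ≤ a) : 0 ≤ φ.1 a := by
  obtain ⟨b, rfl⟩ := CStarAlgebra.nonneg_iff_eq_star_mul_self.1 ha
  exact φ.2.2 b

/-- A state as a positive linear map. -/
noncomputable def StateSpace.toPositive (φ : StateSpace A) : A →ₚ[ℂ] ℂ :=
  PositiveLinearMap.mk₀ ((WeakDual.toStrongDual φ.1 : A →L[ℂ] ℂ) : A →ₗ[ℂ] ℂ)
    fun _ ha => φ.map_nonneg ha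

@[simp] lemma StateSpace.toPositive_apply (φ : StateSpace A) (a : A) :
    φ.toPositive a = φ.1 a := rfl

/-- Cauchy–Schwarz in the GNS pre-Hilbert space, against the class of `1`. -/
lemma StateSpace.norm_apply_sq_le (φ : StateSpace A) (a : A) :
    ‖φ.1 a‖ ^ 2 ≤ (φ.1 (star a * a)).re := by
  have h := norm_inner_le_norm (𝕜 := ℂ) (φ.toPositive.toPreGNS 1) (φ.toPositive.toPreGNS a)
  rw [PositiveLinearMap.preGNS_inner_def, PositiveLinearMap.preGNS_norm_def,
    PositiveLinearMap.preGNS_norm_def] at h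
  simp only [PositiveLinearMap.ofPreGNS_toPreGNS, star_one, one_mul, StateSpace.toPositive_apply,
    φ.map_one, Complex.one_re, Real.sqrt_one] at h
  have h0 : 0 ≤ (φ.1 (star a * a)).re := (Complex.nonneg_iff.1 (φ.2.2 a)).1
  calc ‖φ.1 a‖ ^ 2 ≤ (√(φ.1 (star a * a)).re) ^ 2 := by gcongr
    _ = _ := Real.sq_sqrt h0

lemma StateSpace.norm_apply_le (φ : StateSpace A) (a : A) : ‖φ.1 a‖ ≤ ‖a‖ := by
  have h1 := φ.norm_apply_sq_le a
  have h2 : star a * a ≤ algebraMap ℝ A (‖a‖ ^ 2) := by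
    have := (IsSelfAdjoint.star_mul_self a).le_algebraMap_norm_self
    rwa [CStarRing.norm_star_mul_self, ← sq] at this
  have h3 := φ.map_nonneg (sub_nonneg.2 h2)
  have h4 : φ.1 (algebraMap ℝ A (‖a‖ ^ 2)) = ((‖a‖ ^ 2 : ℝ) : ℂ) := by
    rw [Algebra.algebraMap_eq_smul_one, ← Complex.coe_smul, map_smul, φ.map_one]
    simp
  rw [map_sub, h4] at h3
  have h5 := (Complex.nonneg_iff.1 h3).1
  rw [Complex.sub_re, Complex.ofReal_re] at h5
  exact abs_le_of_sq_le_sq' (h1.trans (by linarith)) (norm_nonneg _) |>.2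

/-- By the C*-identity: the cross terms of `(a - ti)(a + ti)` cancel. -/
lemma norm_add_I_smul_one_sq_le {a : A} (ha : IsSelfAdjoint a) (t : ℝ) :
    ‖a + (t * Complex.I : ℂ) • (1 : A)‖ ^ 2 ≤ ‖a‖ ^ 2 + t ^ 2 := by
  rcases subsingleton_or_nontrivial A with h | h
  · have h1 : a + (t * Complex.I : ℂ) • (1 : A) = 0 := Subsingleton.elim _ _
    rw [h1, norm_zero]
    nlinarith [sq_nonneg ‖a‖, sq_nonneg t]
  have h1 : star (a + (t * Complex.I : ℂ) • (1 : A)) * (a + (t * Complex.I : ℂ) • (1 : A))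
      = a * a + ((t ^ 2 : ℝ) : ℂ) • (1 : A) := by
    have h2 : star (a + (t * Complex.I : ℂ) • (1 : A)) = a - (t * Complex.I : ℂ) • (1 : A) := by
      simp [ha.star_eq, sub_eq_add_neg]
    rw [h2]
    simp only [sub_mul, mul_add, smul_sub, smul_mul_assoc, mul_smul_comm, one_mul, mul_one, smul_smul]
    have h3 : (t * Complex.I * (t * Complex.I) : ℂ) = -((t ^ 2 : ℝ) : ℂ) := by
      push_cast
      linear_combination (t : ℂ) ^ 2 * Complex.I_mul_I
    rw [h3, neg_smul]
    abel
  rw [sq, ← CStarRing.norm_star_mul_self, h1]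
  refine (norm_add_le _ _).trans (add_le_add ?_ ?_)
  · rw [sq]
    exact norm_mul_le _ _
  · rw [norm_smul, norm_one, Complex.norm_real, mul_one, Real.norm_of_nonneg (sq_nonneg t)]

/-- Shifting `a` by `ti` adds `2t · Im φ(a) + t²` to `|φ(a)|²` but at most `t²` to `‖a‖²`; as `t` is
arbitrary, `Im φ(a)` must vanish. -/
lemma im_eq_zero_of_norm_apply_le {φ : A →ₗ[ℂ] ℂ} (h1 : φ 1 = 1) (h : ∀ a, ‖φ a‖ ≤ ‖a‖)
    {a : A} (ha : IsSelfAdjoint a) : (φ a).im = 0 := by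
  have key (t : ℝ) : 2 * (φ a).im * t ≤ ‖a‖ ^ 2 := by
    have h2 := h (a + (t * Complex.I : ℂ) • (1 : A))
    have h3 : ‖φ (a + (t * Complex.I : ℂ) • (1 : A))‖ ^ 2 ≤ ‖a‖ ^ 2 + t ^ 2 :=
      (by gcongr : _ ≤ _).trans (norm_add_I_smul_one_sq_le ha t)
    rw [map_add, map_smul, h1, Complex.sq_norm, Complex.normSq_apply] at h3
    simp at h3
    nlinarith [sq_nonneg (φ a).re, sq_nonneg (φ a).im]
  by_contra hne
  have h2 := key ((‖a‖ ^ 2 + 1) / (2 * (φ a).im))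
  rw [mul_div_cancel₀ _ (by simpa using hne)] at h2
  linarith

/-- For `x ≥ 0` the element `‖x‖1 - x` has norm at most `‖x‖`, so contractivity gives `‖x‖ - Re φ(x)
≤ ‖x‖`. -/
lemma isState_of_norm_apply_le {φ : WeakDual ℂ A} (h1 : φ 1 = 1) (h : ∀ a, ‖φ a‖ ≤ ‖a‖) :
    IsState φ := by
  refine ⟨h1, fun a => ?_⟩
  set x := star a * a with hx
  have hxs : IsSelfAdjoint x := IsSelfAdjoint.star_mul_self a
  have hx0 : 0 ≤ x := star_mul_self_nonneg a
  have him : (φ x).im = 0 := im_eq_zero_of_norm_apply_le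
    (φ := ((WeakDual.toStrongDual φ : A →L[ℂ] ℂ) : A →ₗ[ℂ] ℂ)) h1 h hxs
  have h2 : ‖algebraMap ℝ A ‖x‖ - x‖ ≤ ‖x‖ :=
    (CStarAlgebra.norm_le_iff_le_algebraMap _ (norm_nonneg x)
      (sub_nonneg.2 hxs.le_algebraMap_norm_self)).2 (by simpa using hx0)
  have h3 := (h _).trans h2
  have h4 : φ (algebraMap ℝ A ‖x‖) = (‖x‖ : ℂ) := by
    rw [Algebra.algebraMap_eq_smul_one, ← Complex.coe_smul, map_smul, h1]
    simp
  rw [map_sub, h4] at h3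
  have h5 := (Complex.abs_re_le_norm _).trans h3
  rw [Complex.sub_re, Complex.ofReal_re] at h5
  exact Complex.nonneg_iff.2 ⟨by linarith [(abs_le.1 h5).2], him.symm⟩

lemma StateSpace.im_eq_zero (φ : StateSpace A) {a : A} (ha : IsSelfAdjoint a) :
    (φ.1 a).im = 0 :=
  im_eq_zero_of_norm_apply_le (φ := ((WeakDual.toStrongDual φ.1 : A →L[ℂ] ℂ) : A →ₗ[ℂ] ℂ))
    φ.map_one φ.norm_apply_le ha

/-- A unital contractive functional on a subspace extends to a state. -/
lemma exists_state_extension (M : Submodule ℂ A) (f : M →ₗ[ℂ] ℂ) (hM : (1 : A) ∈ M)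
    (h1 : f ⟨1, hM⟩ = 1) (hf : ∀ x, ‖f x‖ ≤ ‖x‖) :
    ∃ φ : StateSpace A, ∀ x : M, φ.1 (x : A) = f x := by
  have hf' : ∀ x, ‖f x‖ ≤ 1 * ‖x‖ := by simpa using hf
  obtain ⟨g, hg, hn⟩ := exists_extension_norm_eq M (f.mkContinuous 1 hf')
  have hn1 : ‖g‖ ≤ 1 := hn ▸ LinearMap.mkContinuous_norm_le _ zero_le_one _
  refine ⟨⟨StrongDual.toWeakDual g, isState_of_norm_apply_le ?_ fun a => ?_⟩, fun x => ?_⟩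
  · exact (hg ⟨1, hM⟩).trans h1
  · exact (g.le_opNorm a).trans (mul_le_of_le_one_left (norm_nonneg _) hn1)
  · exact hg x

/-- The norm of `a` is attained as `|z|` on the spectrum, and `z` is the value at `a` of a character
of the commutative C*-algebra generated by `a`. That character extends to a state. -/
lemma exists_state_norm_eq [Nontrivial A] {a : A} (ha : IsSelfAdjoint a) :
    ∃ φ : StateSpace A, ‖φ.1 a‖ = ‖a‖ := by
  obtain ⟨z, hz, hzn⟩ := spectrum.exists_nnnorm_eq_spectralRadius a
  rw [ha.spectralRadius_eq_nnnorm, ENNReal.coe_inj] at hzn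
  have : IsStarNormal a := ha.isStarNormal
  let S := StarAlgebra.elemental ℂ a
  have hS : IsClosed (S : Set A) := StarAlgebra.elemental.isClosed ℂ a
  let a' : S := ⟨a, StarAlgebra.elemental.self_mem ℂ a⟩
  have hz' : z ∈ spectrum ℂ a' := (StarSubalgebra.mem_spectrum_iff S).2 hz
  obtain ⟨χ, hχ⟩ := WeakDual.CharacterSpace.mem_spectrum_iff_exists.1 hz'
  obtain ⟨φ, hφ⟩ := exists_state_extension (A := A) (Subalgebra.toSubmodule S.toSubalgebra)
    ((WeakDual.toStrongDual (χ : WeakDual ℂ S) : S →L[ℂ] ℂ) : S →ₗ[ℂ] ℂ) (one_mem S)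
    (map_one χ) (fun x => by
      have := (WeakDual.toStrongDual (χ : WeakDual ℂ S)).le_opNorm x
      have h1 := WeakDual.CharacterSpace.norm_le_norm_one χ
      have h2 : ‖(1 : S)‖ ≤ 1 := by
        have : ‖(1 : A)‖ ≤ 1 := CStarRing.norm_one.le
        exact this
      exact this.trans (mul_le_of_le_one_left (norm_nonneg _) (h1.trans h2)))
  refine ⟨φ, ?_⟩
  have := hφ a'
  have h2 : φ.1 a = z := this.trans hχ
  rw [h2]
  exact congrArg NNReal.toReal hzn

instance [Nontrivial A] : Nonempty (StateSpace A) :=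
  ⟨(exists_state_norm_eq (IsSelfAdjoint.zero A)).choose⟩

lemma norm_le_of_forall_state {a : A} (ha : IsSelfAdjoint a) {c : ℝ} (hc : 0 ≤ c)
    (h : ∀ φ : StateSpace A, ‖φ.1 a‖ ≤ c) : ‖a‖ ≤ c := by
  rcases subsingleton_or_nontrivial A with hA | hA
  · rw [Subsingleton.elim a 0, norm_zero]
    exact hc
  · obtain ⟨φ, hφ⟩ := exists_state_norm_eq ha
    exact hφ ▸ h φ

lemma isCompact_setOf_isState : IsCompact {φ : WeakDual ℂ A | IsState φ} := by
  refine (WeakDual.isCompact_closedBall (𝕜 := ℂ) (E := A) 0 1).of_isClosed_subset ?_ ?_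
  · simp only [IsState, Set.ofPred_and, Set.ofPred_forall]
    refine IsClosed.inter (isClosed_eq (WeakDual.eval_continuous 1) continuous_const)
      (isClosed_iInter fun a => ?_)
    exact isClosed_le continuous_const (WeakDual.eval_continuous _)
  · intro φ hφ
    rw [Set.mem_preimage, mem_closedBall_zero_iff]
    exact ContinuousLinearMap.opNorm_le_bound _ zero_le_one fun a => by
      simpa using StateSpace.norm_apply_le ⟨φ, hφ⟩ a

instance : CompactSpace (StateSpace A) := isCompact_iff_compactSpace.1 isCompact_setOf_isState

lemma StateSpace.continuous_eval (a : A) : Continuous fun φ : StateSpace A => φ.1 a :=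
  (WeakDual.eval_continuous a).comp continuous_subtype_val

lemma StateSpace.ext_selfAdjoint {φ ψ : StateSpace A}
    (h : ∀ a : selfAdjoint A, φ.1 (a : A) = ψ.1 (a : A)) : φ = ψ := by
  refine Subtype.ext (DFunLike.ext _ _ fun a => ?_)
  rw [← realPart_add_I_smul_imaginaryPart a]
  simp only [map_add, map_smul, h]

end States

/-! ### Comparing a compact topology with an extended pseudometric. -/

section Topology

variable {X : Type*} [t : TopologicalSpace X] [CompactSpace X] (m : PseudoEMetricSpace X)

lemma ediam_univ_lt_top_of_compactSpace (h : m.toUniformSpace.toTopologicalSpace = t)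
    (hfin : ∀ x y : X, edist x y < ∞) : @Metric.ediam X m Set.univ < ∞ := by
  subst h
  let m' := PseudoEMetricSpace.toPseudoMetricSpace fun x y : X => (hfin x y).ne
  exact (Metric.isBounded_iff_ediam_ne_top.1 (isCompact_univ (X := X)).isBounded).lt_top

/-- A continuous bijection from a compact space to a Hausdorff space is closed, so continuity of the
identity in one direction suffices. -/
lemma toTopologicalSpace_eq_of_compactSpace (hsep : ∀ x y : X, edist x y = 0 → x = y)
    (hnhds : ∀ x : X, ∀ ε : ℝ≥0∞, 0 < ε → ∀ᶠ y in nhds x, edist y x ≤ ε) :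
    m.toUniformSpace.toTopologicalSpace = t := by
  have hc : @Continuous X X t m.toUniformSpace.toTopologicalSpace id := by
    refine @continuous_iff_continuousAt _ _ t m.toUniformSpace.toTopologicalSpace _ |>.2 fun x => ?_
    refine (Metric.nhds_basis_closedEBall (x := x)).tendsto_right_iff.2 fun ε hε => ?_
    exact hnhds x ε hε
  have hT2 : @T2Space X m.toUniformSpace.toTopologicalSpace := by
    let m' : EMetricSpace X := { m with eq_of_edist_eq_zero := fun {x y} h => hsep x y h }
    exact inferInstance
  have hcl := @Continuous.isClosedMap X X t m.toUniformSpace.toTopologicalSpace _ hT2 id hc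
  refine le_antisymm ?_ (continuous_id_iff_le.1 hc)
  intro s hs
  rw [← @isClosed_compl_iff _ t] at hs
  have := hcl _ hs
  rw [Set.image_id] at this
  exact (@isClosed_compl_iff _ m.toUniformSpace.toTopologicalSpace s).1 this

end Topology

/-! ### The Monge–Kantorovich metric and the total boundedness criterion. -/

section Metric

variable {A : Type*} [CStarAlgebra A] {L : PartialSeminorm A}

lemma enorm_sub_le_mkDist {a : selfAdjoint A} (ha : L a ≤ 1) (φ ψ : StateSpace A) :
    ‖φ.1 (a : A) - ψ.1 (a : A)‖ₑ ≤ mkDist L φ ψ :=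
  le_iSup₂ (f := fun (a : selfAdjoint A) (_ : L a ≤ 1) => ‖φ.1 (a : A) - ψ.1 (a : A)‖ₑ) a ha

lemma mkDist_le_iff {φ ψ : StateSpace A} {c : ℝ≥0∞} :
    mkDist L φ ψ ≤ c ↔ ∀ a : selfAdjoint A, L a ≤ 1 → ‖φ.1 (a : A) - ψ.1 (a : A)‖ₑ ≤ c :=
  iSup₂_le_iff

lemma StateSpace.apply_real_smul (φ : StateSpace A) (r : ℝ) (a : A) :
    φ.1 (r • a) = r * φ.1 a := by
  rw [← Complex.coe_smul, map_smul, smul_eq_mul]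

lemma enorm_sub_le_mul_mkDist {a : selfAdjoint A} {c : ℝ} (hc : 0 < c)
    (ha : L a ≤ ENNReal.ofReal c) (φ ψ : StateSpace A) :
    ‖φ.1 (a : A) - ψ.1 (a : A)‖ₑ ≤ ENNReal.ofReal c * mkDist L φ ψ := by
  have hc' : ‖c⁻¹‖ₑ = (ENNReal.ofReal c)⁻¹ := by
    rw [Real.enorm_of_nonneg (inv_nonneg.2 hc.le), ENNReal.ofReal_inv_of_pos hc]
  have h1 : L (c⁻¹ • a) ≤ 1 := by
    rw [L.smul', hc', mul_comm, ← div_eq_mul_inv]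
    exact ENNReal.div_le_of_le_mul (by simpa using ha)
  have h2 := enorm_sub_le_mkDist h1 φ ψ
  have h3 : ((c⁻¹ • a : selfAdjoint A) : A) = c⁻¹ • (a : A) := rfl
  rw [h3, φ.apply_real_smul, ψ.apply_real_smul, ← mul_sub, enorm_mul, mul_comm] at h2
  have h4 : ‖((c⁻¹ : ℝ) : ℂ)‖ₑ = (ENNReal.ofReal c)⁻¹ := by
    rw [← hc', ← ofReal_norm, ← ofReal_norm, Complex.norm_real]
  rw [h4, ← div_eq_mul_inv] at h2
  rw [mul_comm]
  exact (ENNReal.div_le_iff (by simpa using hc) ENNReal.ofReal_ne_top).1 h2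

lemma apply_eq_of_mkDist_eq_zero (hd : Dense (L.dom : Set (selfAdjoint A))) {φ ψ : StateSpace A}
    (h : mkDist L φ ψ = 0) : φ = ψ := by
  refine StateSpace.ext_selfAdjoint fun a => ?_
  have hcl : IsClosed {a : selfAdjoint A | φ.1 (a : A) = ψ.1 (a : A)} :=
    isClosed_eq ((WeakDual.toStrongDual φ.1).continuous.comp continuous_subtype_val)
      ((WeakDual.toStrongDual ψ.1).continuous.comp continuous_subtype_val)
  refine hcl.closure_subset_iff.2 (fun b hb => ?_) (hd a)
  have hb' : L b < ∞ := hb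
  -- The added `1` keeps the scaling constant positive when `L b = 0`.
  have h1 : L b ≤ ENNReal.ofReal ((L b).toReal + 1) := by
    rw [ENNReal.le_ofReal_iff_toReal_le hb'.ne (by positivity)]
    linarith
  have h2 := enorm_sub_le_mul_mkDist (by positivity) h1 φ ψ
  rw [h, mul_zero, nonpos_iff_eq_zero, enorm_eq_zero] at h2
  exact sub_eq_zero.1 h2

/-- Subtracting the value at a state. -/
noncomputable def center (μ : StateSpace A) (a : selfAdjoint A) : selfAdjoint A :=
  a - (μ.1 (a : A)).re • 1

lemma coe_re_apply (φ : StateSpace A) (a : selfAdjoint A) :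
    (((φ.1 (a : A)).re : ℝ) : ℂ) = φ.1 (a : A) :=
  Complex.ext (Complex.ofReal_re _) (by rw [Complex.ofReal_im, φ.im_eq_zero a.2])

lemma apply_center (μ φ : StateSpace A) (a : selfAdjoint A) :
    φ.1 (center μ a : A) = φ.1 (a : A) - μ.1 (a : A) := by
  have h : (center μ a : A) = a - (μ.1 (a : A)).re • (1 : A) := rfl
  rw [h, map_sub, φ.apply_real_smul, φ.map_one, mul_one, coe_re_apply]

lemma apply_center_le (h1 : L 1 = 0) (μ : StateSpace A) (a : selfAdjoint A) :
    L (center μ a) ≤ L a := by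
  have h := L.add_le' a ((-(μ.1 (a : A)).re) • 1)
  rwa [L.smul', h1, mul_zero, add_zero, neg_smul, ← sub_eq_add_neg] at h

variable {F : ℝ≥0 → ℝ≥0 → ℝ≥0 → ℝ≥0 → ℝ≥0}

lemma IsQuantumCompactMetricSpace.apply_smul_one (hL : IsQuantumCompactMetricSpace F L) (r : ℝ) :
    L (r • 1) = 0 := by
  have : r • (1 : selfAdjoint A) ∈ {a : selfAdjoint A | L a = 0} := hL.ker ▸ ⟨r, rfl⟩
  exact this

lemma IsQuantumCompactMetricSpace.apply_one (hL : IsQuantumCompactMetricSpace F L) : L 1 = 0 := by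
  simpa using hL.apply_smul_one 1

lemma IsQuantumCompactMetricSpace.stateDiam_lt_top (hL : IsQuantumCompactMetricSpace F L) :
    stateDiam L < ∞ :=
  ediam_univ_lt_top_of_compactSpace (mkMetric L) hL.mk_topology hL.mk_finite

lemma mkDist_le_stateDiam (φ ψ : StateSpace A) : mkDist L φ ψ ≤ stateDiam L :=
  @Metric.edist_le_ediam_of_mem _ _ _ _ (mkMetric L) (Set.mem_univ φ) (Set.mem_univ ψ)

lemma IsQuantumCompactMetricSpace.enorm_sub_le (hL : IsQuantumCompactMetricSpace F L)
    {a : selfAdjoint A} (ha : L a < ∞) (φ ψ : StateSpace A) :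
    ‖φ.1 (a : A) - ψ.1 (a : A)‖ₑ ≤ L a * mkDist L φ ψ := by
  rcases eq_or_ne (L a) 0 with h0 | h0
  · have h1 : a ∈ Set.range fun r : ℝ => r • (1 : selfAdjoint A) := hL.ker ▸ h0
    obtain ⟨r, rfl⟩ := h1
    have h3 : ((r • (1 : selfAdjoint A) : selfAdjoint A) : A) = r • (1 : A) := rfl
    simp only [h3, StateSpace.apply_real_smul, StateSpace.map_one, sub_self, enorm_zero, zero_le]
  · have h1 : ENNReal.ofReal (L a).toReal = L a := ENNReal.ofReal_toReal ha.ne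
    have h2 := enorm_sub_le_mul_mkDist (ENNReal.toReal_pos h0 ha.ne) h1.ge φ ψ
    rwa [h1] at h2

/-- Evaluation at self-adjoint elements, as functions on the state space. -/
noncomputable def evalState (a : selfAdjoint A) : BoundedContinuousFunction (StateSpace A) ℂ :=
  BoundedContinuousFunction.mkOfCompact ⟨fun φ => φ.1 (a : A), StateSpace.continuous_eval _⟩

/-- States norm self-adjoint elements, so subsets of `selfAdjoint A` can be studied as sets of
continuous functions on a compact space. -/
lemma isometry_evalState : Isometry (evalState (A := A)) := by
  refine Isometry.of_dist_eq fun a b => ?_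
  have hsub (φ : StateSpace A) : dist (evalState a φ) (evalState b φ)
      = ‖φ.1 ((a - b : selfAdjoint A) : A)‖ := by
    rw [dist_eq_norm]
    change ‖φ.1 (a : A) - φ.1 (b : A)‖ = ‖φ.1 ((a : A) - (b : A))‖
    rw [map_sub]
  have hab : dist a b = ‖((a - b : selfAdjoint A) : A)‖ := dist_eq_norm a b
  refine le_antisymm ?_ ?_
  · rw [BoundedContinuousFunction.dist_le dist_nonneg]
    intro φ
    rw [hsub, hab]
    exact φ.norm_apply_le _
  · rw [hab]
    refine norm_le_of_forall_state (a - b).2 dist_nonneg fun φ => ?_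
    rw [← hsub]
    exact BoundedContinuousFunction.dist_coe_le_dist φ

lemma IsQuantumCompactMetricSpace.eventually_mkDist_lt (hL : IsQuantumCompactMetricSpace F L)
    (φ : StateSpace A) {ε : ℝ≥0∞} (hε : 0 < ε) : ∀ᶠ ψ in nhds φ, mkDist L ψ φ < ε := by
  have h := @Metric.eball_mem_nhds _ (mkMetric L) φ ε hε
  rw [hL.mk_topology] at h
  exact h

/-- Arzelà–Ascoli on the state space. Elements of the slice are 1-Lipschitz functions vanishing at
`μ`, hence bounded by the diameter; they are weak* equicontinuous because the metric induces the
weak* topology. -/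
lemma IsQuantumCompactMetricSpace.totallyBounded (hL : IsQuantumCompactMetricSpace F L)
    (μ : StateSpace A) : TotallyBounded {a : selfAdjoint A | L a ≤ 1 ∧ μ.1 (a : A) = 0} := by
  set K := {a : selfAdjoint A | L a ≤ 1 ∧ μ.1 (a : A) = 0}
  have hcomp : IsCompact (closure (evalState '' K)) := by
    refine BoundedContinuousFunction.arzela_ascoli
      (Metric.closedBall (0 : ℂ) (stateDiam L).toReal) (isCompact_closedBall _ _) _ ?_ ?_
    · rintro _ φ ⟨a, ha, rfl⟩
      rw [mem_closedBall_zero_iff]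
      have h1 := (enorm_sub_le_mkDist ha.1 φ μ).trans (mkDist_le_stateDiam φ μ)
      rw [ha.2, sub_zero] at h1
      rw [← toReal_enorm]
      exact ENNReal.toReal_mono hL.stateDiam_lt_top.ne h1
    · intro φ
      rw [Metric.equicontinuousAt_iff_right]
      intro ε hε
      filter_upwards [hL.eventually_mkDist_lt φ (ENNReal.ofReal_pos.2 hε)] with ψ hψ
      rintro ⟨_, a, ha, rfl⟩
      have h1 := (enorm_sub_le_mkDist ha.1 ψ φ).trans_lt hψ
      rw [← ofReal_norm, ENNReal.ofReal_lt_ofReal_iff hε] at h1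
      rw [dist_comm, dist_eq_norm]
      exact h1
  exact TotallyBounded.subset (Set.image_subset_iff.1 subset_closure)
    (totallyBounded_preimage isometry_evalState.isUniformInducing hcomp.totallyBounded)

lemma mkDist_lt_top_of_totallyBounded (h1 : L 1 = 0) (μ : StateSpace A)
    (hK : TotallyBounded {a : selfAdjoint A | L a ≤ 1 ∧ μ.1 (a : A) = 0}) (φ ψ : StateSpace A) :
    mkDist L φ ψ < ∞ := by
  obtain ⟨R, -, hR⟩ := hK.isBounded.exists_pos_norm_le
  refine ((mkDist_le_iff (c := ENNReal.ofReal (R + R))).2 fun a ha => ?_).trans_lt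
    ENNReal.ofReal_lt_top
  have h2 := hR (center μ a) ⟨(apply_center_le h1 μ a).trans ha, by rw [apply_center, sub_self]⟩
  have h3 : φ.1 (a : A) - ψ.1 (a : A) = φ.1 (center μ a : A) - ψ.1 (center μ a : A) := by
    rw [apply_center, apply_center]
    ring
  rw [h3, ← ofReal_norm]
  refine ENNReal.ofReal_le_ofReal ((norm_sub_le _ _).trans (add_le_add ?_ ?_))
  · exact (φ.norm_apply_le _).trans h2
  · exact (ψ.norm_apply_le _).trans h2

/-- On a finite net of the slice, weak* closeness of two states is a finite condition, and the net
controls the whole unit ball uniformly. -/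
lemma mk_topology_of_totallyBounded (hd : Dense (L.dom : Set (selfAdjoint A))) (h1 : L 1 = 0)
    (μ : StateSpace A) (hK : TotallyBounded {a : selfAdjoint A | L a ≤ 1 ∧ μ.1 (a : A) = 0}) :
    (mkMetric L).toUniformSpace.toTopologicalSpace =
      (inferInstance : TopologicalSpace (StateSpace A)) := by
  refine toTopologicalSpace_eq_of_compactSpace (mkMetric L)
    (fun φ ψ h => apply_eq_of_mkDist_eq_zero hd h) fun φ ε hε => ?_
  -- The factor 3 covers two approximation errors and one difference at a net point; `ε` may be `∞`,
  -- hence the detour through a finite `c`.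
  obtain ⟨δ, hδ0, hδ⟩ : ∃ δ : ℝ, 0 < δ ∧ ENNReal.ofReal (3 * δ) ≤ ε := by
    obtain ⟨c, hc0, hc⟩ := ENNReal.lt_iff_exists_nnreal_btwn.1 hε
    refine ⟨c / 3, by have : 0 < c := by simpa using hc0
                      positivity, ?_⟩
    rw [mul_div_cancel₀ _ (by norm_num), ENNReal.ofReal_coe_nnreal]
    exact hc.le
  obtain ⟨s, hs, hcov⟩ := Metric.totallyBounded_iff.1 hK δ hδ0
  have hev : ∀ᶠ ψ : StateSpace A in nhds φ, ∀ y ∈ s, ‖ψ.1 (y : A) - φ.1 (y : A)‖ < δ := by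
    refine (Filter.eventually_all_finite hs).2 fun y _ => ?_
    have h2 := Metric.tendsto_nhds.1 ((StateSpace.continuous_eval (y : A)).tendsto φ) δ hδ0
    simpa only [dist_eq_norm] using h2
  filter_upwards [hev] with ψ hψ
  refine (mkDist_le_iff.2 fun a ha => ?_).trans hδ
  have h2 := hcov ⟨(apply_center_le h1 μ a).trans ha, by rw [apply_center, sub_self]⟩
  simp only [Set.mem_iUnion] at h2
  obtain ⟨y, hy, hay⟩ := h2
  have hay' : ‖(center μ a : A) - (y : A)‖ < δ := by
    rw [Metric.mem_ball, dist_eq_norm] at hay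
    exact hay
  have h3 : ψ.1 (a : A) - φ.1 (a : A) = ψ.1 ((center μ a : A) - (y : A))
      + (ψ.1 (y : A) - φ.1 (y : A)) - φ.1 ((center μ a : A) - (y : A)) := by
    rw [map_sub, map_sub, apply_center, apply_center]
    ring
  rw [h3, ← ofReal_norm]
  refine ENNReal.ofReal_le_ofReal ?_
  have h4 := (ψ.norm_apply_le _).trans hay'.le
  have h5 := (φ.norm_apply_le _).trans hay'.le
  have h6 := hψ y hy
  refine (norm_sub_le _ _).trans ?_
  have h7 := norm_add_le (ψ.1 ((center μ a : A) - (y : A))) (ψ.1 (y : A) - φ.1 (y : A))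
  linarith

end Metric

lemma totallyBounded_prod {α β : Type*} [UniformSpace α] [UniformSpace β] {s : Set α} {t : Set β}
    (hs : TotallyBounded s) (ht : TotallyBounded t) : TotallyBounded (s ×ˢ t) := by
  rw [totallyBounded_iff_ultrafilter] at *
  intro f hf
  rw [cauchy_prod_iff]
  have hf' := Filter.le_principal_iff.1 hf
  refine ⟨hs (f.map Prod.fst) ?_, ht (f.map Prod.snd) ?_⟩
  · exact Filter.le_principal_iff.2 (Filter.mem_map.2 (Filter.mem_of_superset hf' fun x hx => hx.1))
  · exact Filter.le_principal_iff.2 (Filter.mem_map.2 (Filter.mem_of_superset hf' fun x hx => hx.2))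

/-- An injective *-homomorphism is isometric, so `φ ∘ ρ⁻¹` is a unital contraction on the range of
`ρ` and extends to a state. -/
lemma exists_state_comp_eq {E C : Type*} [CStarAlgebra E] [CStarAlgebra C] (ρ : E →⋆ₐ[ℂ] C)
    (hρ : Function.Injective ρ) (φ : StateSpace E) :
    ∃ Ω : StateSpace C, ∀ e, Ω.1 (ρ e) = φ.1 e := by
  let e := LinearEquiv.ofInjective (ρ : E →ₗ[ℂ] C) hρ
  have h1 : (1 : C) ∈ LinearMap.range (ρ : E →ₗ[ℂ] C) := ⟨1, map_one ρ⟩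
  have he (x : E) : e.symm ⟨ρ x, x, rfl⟩ = x := e.symm_apply_apply x
  obtain ⟨Ω, hΩ⟩ := exists_state_extension (LinearMap.range (ρ : E →ₗ[ℂ] C))
    (((WeakDual.toStrongDual φ.1 : E →L[ℂ] ℂ) : E →ₗ[ℂ] ℂ) ∘ₗ e.symm.toLinearMap) h1 (by
      have h2 : e.symm ⟨1, h1⟩ = 1 := by
        rw [LinearEquiv.symm_apply_eq]
        exact Subtype.ext (map_one ρ).symm
      change φ.1 (e.symm ⟨1, h1⟩) = 1
      rw [h2, φ.map_one]) (by
      rintro ⟨_, x, rfl⟩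
      change ‖φ.1 (e.symm ⟨ρ x, x, rfl⟩)‖ ≤ ‖ρ x‖
      rw [he, NonUnitalStarAlgHom.norm_map ρ hρ]
      exact φ.norm_apply_le x)
  refine ⟨Ω, fun x => (hΩ ⟨ρ x, x, rfl⟩).trans ?_⟩
  change φ.1 (e.symm ⟨ρ x, x, rfl⟩) = φ.1 x
  rw [he]

/-! ### Leibniz estimates for differences of Jordan and Lie products. -/

section Products

variable {C : Type*} [NormedRing C] {u v u' v' : C} {p q α β : ℝ}

lemma norm_mul_sub_mul_le (hu : ‖u‖ ≤ p) (hv' : ‖v'‖ ≤ q) (hα : ‖u - u'‖ ≤ α)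
    (hβ : ‖v - v'‖ ≤ β) : ‖u * v - u' * v'‖ ≤ p * β + q * α := by
  have h : u * v - u' * v' = u * (v - v') + (u - u') * v' := by noncomm_ring
  rw [h, mul_comm q]
  have hα0 := (norm_nonneg _).trans hα
  have hp0 := (norm_nonneg _).trans hu
  refine (norm_add_le _ _).trans (add_le_add ((norm_mul_le _ _).trans ?_)
    ((norm_mul_le _ _).trans ?_)) <;> gcongr

variable [NormedAlgebra ℂ C]

lemma norm_smul_add_sub_smul_add_le {c : ℂ} (hc : ‖c‖ = 1 / 2) (hu : ‖u‖ ≤ p) (hu' : ‖u'‖ ≤ p)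
    (hv : ‖v‖ ≤ q) (hv' : ‖v'‖ ≤ q) (hα : ‖u - u'‖ ≤ α) (hβ : ‖v - v'‖ ≤ β) :
    ‖c • (u * v + v * u) - c • (u' * v' + v' * u')‖ ≤ p * β + q * α := by
  have h1 := norm_mul_sub_mul_le hu hv' hα hβ
  have h2 := norm_mul_sub_mul_le hv hu' hβ hα
  rw [← smul_sub, norm_smul, hc, add_sub_add_comm]
  have h3 := norm_add_le (u * v - u' * v') (v * u - v' * u')
  linarith

lemma norm_smul_sub_sub_smul_sub_le {c : ℂ} (hc : ‖c‖ = 1 / 2) (hu : ‖u‖ ≤ p) (hu' : ‖u'‖ ≤ p)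
    (hv : ‖v‖ ≤ q) (hv' : ‖v'‖ ≤ q) (hα : ‖u - u'‖ ≤ α) (hβ : ‖v - v'‖ ≤ β) :
    ‖c • (u * v - v * u) - c • (u' * v' - v' * u')‖ ≤ p * β + q * α := by
  have h1 := norm_mul_sub_mul_le hu hv' hα hβ
  have h2 := norm_mul_sub_mul_le hv hu' hβ hα
  rw [← smul_sub, norm_smul, hc, sub_sub_sub_comm]
  have h3 := norm_sub_le (u * v - u' * v') (v * u - v' * u')
  linarith

end Products

/-- The scalar is the value of `a` at an arbitrary state; every other state differs from it by at
most `L(a)` times the diameter. -/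
lemma IsQuantumCompactMetricSpace.exists_enorm_sub_smul_one_le {A : Type*} [CStarAlgebra A]
    [Nontrivial A] {F : ℝ≥0 → ℝ≥0 → ℝ≥0 → ℝ≥0 → ℝ≥0} {L : PartialSeminorm A}
    (hL : IsQuantumCompactMetricSpace F L) {a : selfAdjoint A} (ha : L a < ∞) :
    ∃ s : ℝ, ‖(a : A) - s • (1 : A)‖ₑ ≤ L a * stateDiam L := by
  obtain ⟨μ⟩ : Nonempty (StateSpace A) := inferInstance
  refine ⟨(μ.1 (a : A)).re, ?_⟩
  have hfin : L a * stateDiam L ≠ ∞ := (ENNReal.mul_lt_top ha hL.stateDiam_lt_top).ne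
  rw [← ofReal_norm, ENNReal.ofReal_le_iff_le_toReal hfin]
  refine norm_le_of_forall_state (center μ a).2 ENNReal.toReal_nonneg fun φ => ?_
  rw [apply_center, ← toReal_enorm]
  refine ENNReal.toReal_mono hfin ((hL.enorm_sub_le ha φ μ).trans ?_)
  gcongr
  exact mkDist_le_stateDiam φ μ

/-! ### The glued seminorm on the direct sum: metric space, tunnel, extent. -/

section Glue

variable {A B : Type*} [CStarAlgebra A] [CStarAlgebra B]

/-- The self-adjoint element of a product with given components. -/
def saPair (a : selfAdjoint A) (b : selfAdjoint B) : selfAdjoint (A × B) :=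
  ⟨(a, b), Prod.ext a.2 b.2⟩

lemma continuous_starAlgHom {E : Type*} [CStarAlgebra E] (π : E →⋆ₐ[ℂ] A) : Continuous π :=
  AddMonoidHomClass.continuous_of_bound π 1 (by simpa using NonUnitalStarAlgHom.norm_apply_le π)

lemma continuous_saMap {E : Type*} [CStarAlgebra E] (π : E →⋆ₐ[ℂ] A) : Continuous (saMap π) :=
  ((continuous_starAlgHom π).comp continuous_subtype_val).subtype_mk _

variable {H : Type*} [NormedAddCommGroup H] [InnerProductSpace ℂ H] [CompleteSpace H]
  {LA : PartialSeminorm A} {LB : PartialSeminorm B}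
  {πA : A →⋆ₐ[ℂ] (H →L[ℂ] H)} {πB : B →⋆ₐ[ℂ] (H →L[ℂ] H)} {r : ℝ≥0∞}

lemma glue_le_iff {x : selfAdjoint (A × B)} {c : ℝ≥0∞} :
    glue LA LB πA πB r x ≤ c ↔ LA (saMap (StarAlgHom.fst ℂ A B) x) ≤ c ∧
      LB (saMap (StarAlgHom.snd ℂ A B) x) ≤ c ∧
      ‖πA (x : A × B).1 - πB (x : A × B).2‖ₑ / r ≤ c := by
  simp only [glue, max_le_iff, and_assoc]

lemma glue_lt_top_iff (hr : r ≠ 0) {x : selfAdjoint (A × B)} :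
    glue LA LB πA πB r x < ∞ ↔ LA (saMap (StarAlgHom.fst ℂ A B) x) < ∞ ∧
      LB (saMap (StarAlgHom.snd ℂ A B) x) < ∞ := by
  simp only [glue, max_lt_iff]
  exact and_iff_left (ENNReal.div_lt_top enorm_ne_top hr)

lemma map_real_smul_one (π : A →⋆ₐ[ℂ] (H →L[ℂ] H)) (s : ℝ) :
    π (s • (1 : A)) = s • (1 : H →L[ℂ] H) := by
  rw [← Complex.coe_smul, map_smul, map_one, Complex.coe_smul]

variable {F : ℝ≥0 → ℝ≥0 → ℝ≥0 → ℝ≥0 → ℝ≥0}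

lemma glue_quasiLeibniz (hF : IsPermissible F) (hA : IsQuasiLeibniz F LA)
    (hB : IsQuasiLeibniz F LB) (hr : r ≠ 0) (hr' : r ≠ ∞) :
    IsQuasiLeibniz F (glue LA LB πA πB r) := by
  intro x hx y hy
  have hxt : glue LA LB πA πB r x < ∞ := hx
  have hyt : glue LA LB πA πB r y < ∞ := hy
  have hx' := (glue_lt_top_iff hr).1 hxt
  have hy' := (glue_lt_top_iff hr).1 hyt
  obtain ⟨hx1, hx2, hx3⟩ := glue_le_iff.1 (le_refl (glue LA LB πA πB r x))
  obtain ⟨hy1, hy2, hy3⟩ := glue_le_iff.1 (le_refl (glue LA LB πA πB r y))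
  obtain ⟨jA, lA⟩ := hA _ hx'.1 _ hy'.1
  obtain ⟨jB, lB⟩ := hB _ hx'.2 _ hy'.2
  set X := (glue LA LB πA πB r x).toNNReal with hX
  set Y := (glue LA LB πA πB r y).toNNReal with hY
  rw [← ENNReal.coe_toNNReal hxt.ne, ← hX, ENNReal.div_le_iff hr hr'] at hx3
  rw [← ENNReal.coe_toNNReal hyt.ne, ← hY, ENNReal.div_le_iff hr hr'] at hy3
  have mA : F ‖(saMap (StarAlgHom.fst ℂ A B) x : A)‖₊ ‖(saMap (StarAlgHom.fst ℂ A B) y : A)‖₊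
      (LA (saMap (StarAlgHom.fst ℂ A B) x)).toNNReal
      (LA (saMap (StarAlgHom.fst ℂ A B) y)).toNNReal ≤ F ‖(x : A × B)‖₊ ‖(y : A × B)‖₊ X Y :=
    hF.mono _ _ _ _ _ _ _ _ (norm_fst_le (x : A × B)) (norm_fst_le (y : A × B))
      (ENNReal.toNNReal_mono hxt.ne hx1) (ENNReal.toNNReal_mono hyt.ne hy1)
  have mB : F ‖(saMap (StarAlgHom.snd ℂ A B) x : B)‖₊ ‖(saMap (StarAlgHom.snd ℂ A B) y : B)‖₊
      (LB (saMap (StarAlgHom.snd ℂ A B) x)).toNNReal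
      (LB (saMap (StarAlgHom.snd ℂ A B) y)).toNNReal ≤ F ‖(x : A × B)‖₊ ‖(y : A × B)‖₊ X Y :=
    hF.mono _ _ _ _ _ _ _ _ (norm_snd_le (x : A × B)) (norm_snd_le (y : A × B))
      (ENNReal.toNNReal_mono hxt.ne hx2) (ENNReal.toNNReal_mono hyt.ne hy2)
  -- After division by `r` the bound is `x ly + y lx`, which permissibility places below `F`.
  have key (z : H →L[ℂ] H) (hz : ‖z‖ ≤ ‖(x : A × B)‖ * (Y * r.toReal)
      + ‖(y : A × B)‖ * (X * r.toReal)) :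
      ‖z‖ₑ / r ≤ F ‖(x : A × B)‖₊ ‖(y : A × B)‖₊ X Y := by
    rw [ENNReal.div_le_iff hr hr']
    refine le_trans ?_ (mul_le_mul_left (ENNReal.coe_le_coe.2 (hF.le _ _ _ _)) r)
    rw [← ENNReal.coe_toNNReal hr', ← ENNReal.coe_mul, enorm_eq_nnnorm, ENNReal.coe_le_coe,
      ← NNReal.coe_le_coe]
    refine hz.trans (le_of_eq ?_)
    push_cast
    rw [ENNReal.coe_toNNReal_eq_toReal]
    ring
  have real_le {z : H →L[ℂ] H} {c : ℝ≥0} (hz : ‖z‖ₑ ≤ c * r) : ‖z‖ ≤ c * r.toReal := by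
    have := ENNReal.toReal_mono (ENNReal.mul_ne_top ENNReal.coe_ne_top hr') hz
    rwa [toReal_enorm, ENNReal.toReal_mul, ENNReal.coe_toReal] at this
  have nA (z : A × B) : ‖πA z.1‖ ≤ ‖z‖ :=
    (NonUnitalStarAlgHom.norm_apply_le πA _).trans (norm_fst_le z)
  have nB (z : A × B) : ‖πB z.2‖ ≤ ‖z‖ :=
    (NonUnitalStarAlgHom.norm_apply_le πB _).trans (norm_snd_le z)
  refine ⟨glue_le_iff.2 ⟨jA.trans (ENNReal.coe_le_coe.2 mA), jB.trans (ENNReal.coe_le_coe.2 mB),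
    key _ ?_⟩, glue_le_iff.2 ⟨lA.trans (ENNReal.coe_le_coe.2 mA),
    lB.trans (ENNReal.coe_le_coe.2 mB), key _ ?_⟩⟩
  · have := norm_smul_add_sub_smul_add_le (c := (1 / 2 : ℂ)) (by simp) (nA x) (nB x) (nA y) (nB y)
      (real_le hx3) (real_le hy3)
    refine le_trans (le_of_eq ?_) this
    simp only [jordanProd, Prod.smul_fst, Prod.smul_snd, Prod.fst_add, Prod.snd_add, Prod.fst_mul,
      Prod.snd_mul, map_smul, map_add, map_mul]
  · have := norm_smul_sub_sub_smul_sub_le (c := (1 / (2 * Complex.I) : ℂ)) (by simp) (nA x) (nB x)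
      (nA y) (nB y) (real_le hx3) (real_le hy3)
    refine le_trans (le_of_eq ?_) this
    simp only [lieProd, Prod.smul_fst, Prod.smul_snd, Prod.fst_sub, Prod.snd_sub, Prod.fst_mul,
      Prod.snd_mul, map_smul, map_sub, map_mul]

lemma glue_dense (hA : Dense (LA.dom : Set (selfAdjoint A)))
    (hB : Dense (LB.dom : Set (selfAdjoint B))) (hr : r ≠ 0) :
    Dense ((glue LA LB πA πB r).dom : Set (selfAdjoint (A × B))) := by
  have hc : Continuous fun p : selfAdjoint A × selfAdjoint B => saPair p.1 p.2 := by
    unfold saPair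
    fun_prop
  have hs : Function.Surjective fun p : selfAdjoint A × selfAdjoint B => saPair p.1 p.2 :=
    fun x => ⟨(saMap (StarAlgHom.fst ℂ A B) x, saMap (StarAlgHom.snd ℂ A B) x), rfl⟩
  refine (hs.denseRange.dense_image hc (hA.prod hB)).mono ?_
  rintro _ ⟨p, hp, rfl⟩
  exact (glue_lt_top_iff hr).2 hp

/-- The `A`-component lies in a totally bounded slice of norm at most `R`. The bridge term and
isometry of `πB` give `‖b‖ ≤ R + r`, so `b` is an element of the slice at `ν` plus a scalar from a
compact interval. -/
lemma glue_totallyBounded [Nontrivial B] (hA : IsQuantumCompactMetricSpace F LA)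
    (hB : IsQuantumCompactMetricSpace F LB) (hπB : Function.Injective πB)
    (hr : r ≠ 0) (hr' : r ≠ ∞) (μ : StateSpace A) :
    TotallyBounded {x : selfAdjoint (A × B) | glue LA LB πA πB r x ≤ 1 ∧
      (dualMap (StarAlgHom.fst ℂ A B) μ).1 (x : A × B) = 0} := by
  obtain ⟨ν⟩ : Nonempty (StateSpace B) := inferInstance
  have hKA := hA.totallyBounded μ
  have hKB := hB.totallyBounded ν
  obtain ⟨R, -, hR⟩ := hKA.isBounded.exists_pos_norm_le
  let Φ : selfAdjoint A × selfAdjoint B × ℝ → selfAdjoint (A × B) :=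
    fun p => saPair p.1 (p.2.1 + p.2.2 • 1)
  have hΦ : UniformContinuous Φ := by
    refine UniformContinuous.subtype_mk ?_ _
    refine (uniformContinuous_subtype_val.comp uniformContinuous_fst).prodMk ?_
    refine (uniformContinuous_subtype_val.comp
      (uniformContinuous_fst.comp uniformContinuous_snd)).add ?_
    exact (ContinuousLinearMap.toSpanSingleton ℝ (1 : B)).uniformContinuous.comp
      (uniformContinuous_snd.comp uniformContinuous_snd)
  refine TotallyBounded.subset ?_ ((totallyBounded_prod hKA (totallyBounded_prod hKB
    (isCompact_closedBall (0 : ℝ) (R + r.toReal)).totallyBounded)).image hΦ)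
  rintro x ⟨hx, hx0⟩
  obtain ⟨h1, h2, h3⟩ := glue_le_iff.1 hx
  set a := saMap (StarAlgHom.fst ℂ A B) x with ha
  set b := saMap (StarAlgHom.snd ℂ A B) x with hb
  have haK : a ∈ {a : selfAdjoint A | LA a ≤ 1 ∧ μ.1 (a : A) = 0} := ⟨h1, hx0⟩
  refine ⟨(a, center ν b, (ν.1 (b : B)).re), ⟨haK,
    ⟨(apply_center_le hB.apply_one ν b).trans h2, by rw [apply_center, sub_self]⟩, ?_⟩, ?_⟩
  · rw [mem_closedBall_zero_iff]
    have h4 : ‖πA (a : A) - πB (b : B)‖ ≤ r.toReal := by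
      rw [ENNReal.div_le_iff hr hr', one_mul] at h3
      have := ENNReal.toReal_mono hr' h3
      rwa [toReal_enorm] at this
    have h5 : ‖(b : B)‖ = ‖πB (b : B)‖ := (NonUnitalStarAlgHom.norm_map πB hπB _).symm
    have h6 : ‖πA (a : A)‖ ≤ R := (NonUnitalStarAlgHom.norm_apply_le πA _).trans (hR a haK)
    have h7 := norm_sub_norm_le (πB (b : B)) (πA (a : A))
    rw [norm_sub_rev] at h7
    have h8 := ν.norm_apply_le (b : B)
    have h9 : ‖(ν.1 (b : B)).re‖ ≤ ‖ν.1 (b : B)‖ := Complex.abs_re_le_norm _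
    linarith
  · have h4 : center ν b + (ν.1 (b : B)).re • 1 = b := sub_add_cancel _ _
    change saPair a (center ν b + (ν.1 (b : B)).re • 1) = x
    rw [h4]
    rfl

lemma glue_isQuantumCompactMetricSpace [Nontrivial A] [Nontrivial B] (hF : IsPermissible F)
    (hA : IsQuantumCompactMetricSpace F LA) (hB : IsQuantumCompactMetricSpace F LB)
    (hπB : Function.Injective πB) (hr : r ≠ 0) (hr' : r ≠ ∞) :
    IsQuantumCompactMetricSpace F (glue LA LB πA πB r) := by
  have hker : {x : selfAdjoint (A × B) | glue LA LB πA πB r x = 0} =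
      Set.range fun s : ℝ => s • (1 : selfAdjoint (A × B)) := by
    ext x
    rw [Set.mem_ofPred_eq, ← nonpos_iff_eq_zero, glue_le_iff]
    simp only [nonpos_iff_eq_zero]
    constructor
    · rintro ⟨h1, -, h3⟩
      have h1' : saMap (StarAlgHom.fst ℂ A B) x ∈ {a | LA a = 0} := h1
      rw [hA.ker] at h1'
      obtain ⟨s, hs⟩ := h1'
      have hs' : (x : A × B).1 = s • (1 : A) := (congrArg Subtype.val hs).symm
      have h4 : ‖πA (x : A × B).1 - πB (x : A × B).2‖ₑ = 0 := by
        simpa [hr'] using h3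
      rw [enorm_eq_zero, sub_eq_zero, hs', map_real_smul_one, ← map_real_smul_one πB] at h4
      exact ⟨s, Subtype.ext (Prod.ext hs'.symm (hπB h4))⟩
    · rintro ⟨s, rfl⟩
      refine ⟨hA.apply_smul_one s, hB.apply_smul_one s, ?_⟩
      change ‖πA (s • (1 : A)) - πB (s • (1 : B))‖ₑ / r = 0
      rw [map_real_smul_one, map_real_smul_one, sub_self, enorm_zero, ENNReal.zero_div]
  have hone : glue LA LB πA πB r 1 = 0 := by
    have : (1 : selfAdjoint (A × B)) ∈ {x | glue LA LB πA πB r x = 0} := hker ▸ ⟨1, one_smul _ _⟩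
    exact this
  have hd := glue_dense (πA := πA) (πB := πB) hA.dense_dom hB.dense_dom hr
  obtain ⟨μ⟩ : Nonempty (StateSpace A) := inferInstance
  have htb := glue_totallyBounded (πA := πA) hA hB hπB hr hr' μ
  refine ⟨hd, fun x hx y hy => ?_, fun x hx y hy => ?_, hker, ?_,
    mkDist_lt_top_of_totallyBounded hone _ htb, mk_topology_of_totallyBounded hd hone _ htb,
    glue_quasiLeibniz hF hA.quasiLeibniz hB.quasiLeibniz hr hr'⟩
  · have hx' := (glue_lt_top_iff hr).1 hx
    have hy' := (glue_lt_top_iff hr).1 hy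
    exact (glue_lt_top_iff hr).2
      ⟨hA.jordan_mem _ hx'.1 _ hy'.1, hB.jordan_mem _ hx'.2 _ hy'.2⟩
  · have hx' := (glue_lt_top_iff hr).1 hx
    have hy' := (glue_lt_top_iff hr).1 hy
    exact (glue_lt_top_iff hr).2 ⟨hA.lie_mem _ hx'.1 _ hy'.1, hB.lie_mem _ hx'.2 _ hy'.2⟩
  · simp only [glue_le_iff, Set.ofPred_and]
    refine (hA.closed.preimage (continuous_saMap _)).inter
      ((hB.closed.preimage (continuous_saMap _)).inter ?_)
    simp only [ENNReal.div_le_iff hr hr']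
    refine isClosed_le ?_ continuous_const
    exact (((continuous_starAlgHom πA).comp (continuous_fst.comp continuous_subtype_val)).sub
      ((continuous_starAlgHom πB).comp (continuous_snd.comp continuous_subtype_val))).enorm

theorem glue_isTunnel [Nontrivial A] [Nontrivial B] (hF : IsPermissible F)
    (hA : IsQuantumCompactMetricSpace F LA) (hB : IsQuantumCompactMetricSpace F LB)
    (hπB : Function.Injective πB) (hr : r ≠ 0) (hr' : r ≠ ∞)
    (hrA : stateDiam LA ≤ r) (hrB : stateDiam LB ≤ r) :
    IsTunnel F LA LB (glue LA LB πA πB r) (StarAlgHom.fst ℂ A B) (StarAlgHom.snd ℂ A B) := by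
  refine ⟨glue_isQuantumCompactMetricSpace hF hA hB hπB hr hr', Prod.fst_surjective,
    Prod.snd_surjective, fun a => ?_, fun b => ?_⟩
  · refine le_antisymm (le_iInf₂ fun x hx => hx ▸ (glue_le_iff.1 le_rfl).1) ?_
    rcases eq_top_or_lt_top (LA a) with ha | ha
    · rw [ha]
      exact le_top
    obtain ⟨s, hs⟩ := hA.exists_enorm_sub_smul_one_le ha
    -- The lift pairs `a` with a scalar, which `LB` kills and which both representations send to the
    -- same operator.
    refine iInf₂_le_of_le (saPair a (s • 1)) rfl (glue_le_iff.2 ⟨le_rfl, ?_, ?_⟩)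
    · exact (hB.apply_smul_one s).le.trans zero_le
    · refine ENNReal.div_le_of_le_mul ?_
      change ‖πA (a : A) - πB (s • (1 : B))‖ₑ ≤ _
      rw [map_real_smul_one, ← map_real_smul_one πA, ← map_sub]
      refine le_trans ?_ (hs.trans (mul_le_mul_right hrA _))
      rw [← ofReal_norm, ← ofReal_norm]
      exact ENNReal.ofReal_le_ofReal (NonUnitalStarAlgHom.norm_apply_le πA _)
  · refine le_antisymm (le_iInf₂ fun x hx => hx ▸ (glue_le_iff.1 le_rfl).2.1) ?_
    rcases eq_top_or_lt_top (LB b) with hb | hb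
    · rw [hb]
      exact le_top
    obtain ⟨s, hs⟩ := hB.exists_enorm_sub_smul_one_le hb
    refine iInf₂_le_of_le (saPair (s • 1) b) rfl (glue_le_iff.2 ⟨?_, le_rfl, ?_⟩)
    · exact (hA.apply_smul_one s).le.trans zero_le
    · refine ENNReal.div_le_of_le_mul ?_
      change ‖πA (s • (1 : A)) - πB (b : B)‖ₑ ≤ _
      rw [map_real_smul_one, ← map_real_smul_one πB, ← map_sub, ← enorm_neg, ← map_neg, neg_sub]
      refine le_trans ?_ (hs.trans (mul_le_mul_right hrB _))
      rw [← ofReal_norm, ← ofReal_norm]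
      exact ENNReal.ofReal_le_ofReal (NonUnitalStarAlgHom.norm_apply_le πB _)

theorem glue_extent_le (hπA : Function.Injective πA) (hπB : Function.Injective πB)
    (hr : r ≠ 0) (hr' : r ≠ ∞) :
    extent (glue LA LB πA πB r) (StarAlgHom.fst ℂ A B) (StarAlgHom.snd ℂ A B) ≤ r := by
  have hdist {x : selfAdjoint (A × B)} (hx : glue LA LB πA πB r x ≤ 1) :
      ‖πA (x : A × B).1 - πB (x : A × B).2‖ₑ ≤ r := by
    have := (glue_le_iff.1 hx).2.2
    rwa [ENNReal.div_le_iff hr hr', one_mul] at this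
  have hstate {C : Type _} [CStarAlgebra C] (Ω : StateSpace C) (c : C) : ‖Ω.1 c‖ₑ ≤ ‖c‖ₑ := by
    rw [← ofReal_norm, ← ofReal_norm]
    exact ENNReal.ofReal_le_ofReal (Ω.norm_apply_le c)
  have hleft (T : H →L[ℂ] H) : ‖((T, 0) : (H →L[ℂ] H) × (H →L[ℂ] H))‖ₑ = ‖T‖ₑ := by
    rw [← ofReal_norm, ← ofReal_norm, Prod.norm_mk, norm_zero, max_eq_left (norm_nonneg T)]
  have hright (T : H →L[ℂ] H) : ‖((0, T) : (H →L[ℂ] H) × (H →L[ℂ] H))‖ₑ = ‖T‖ₑ := by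
    rw [← ofReal_norm, ← ofReal_norm, Prod.norm_mk, norm_zero, max_eq_right (norm_nonneg T)]
  let ρ : A × B →⋆ₐ[ℂ] (H →L[ℂ] H) × (H →L[ℂ] H) :=
    (πA.comp (StarAlgHom.fst ℂ A B)).prod (πB.comp (StarAlgHom.snd ℂ A B))
  have hρ : Function.Injective ρ := fun x y hxy =>
    Prod.ext (hπA (congrArg Prod.fst hxy)) (hπB (congrArg Prod.snd hxy))
  refine max_le ?_ ?_
  · refine @Metric.hausdorffEDist_le_of_mem_edist _ (mkMetric _) _ _ _ (fun ω _ => ?_)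
      fun φ _ => ⟨φ, Set.mem_univ φ, (@edist_self _ (mkMetric _) φ).le.trans zero_le⟩
    obtain ⟨Ω, hΩ⟩ := exists_state_comp_eq ρ hρ ω
    -- The nearby state of `A` feeds `πA a` into both coordinates of `Ω`; only the second coordinate
    -- changes, by `πB b - πA a`.
    refine ⟨_, ⟨dualMap (πA.prod πA) Ω, rfl⟩, mkDist_le_iff.2 fun x hx => ?_⟩
    have h1 : ω.1 (x : A × B) - Ω.1 (πA (x : A × B).1, πA (x : A × B).1)
        = Ω.1 (0, πB (x : A × B).2 - πA (x : A × B).1) := by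
      rw [← hΩ, ← map_sub]
      congr 1
      exact Prod.ext (sub_self _) rfl
    change ‖ω.1 (x : A × B) - Ω.1 (πA (x : A × B).1, πA (x : A × B).1)‖ₑ ≤ r
    rw [h1]
    refine (hstate _ _).trans ?_
    rw [hright, ← enorm_neg, neg_sub]
    exact hdist hx
  · refine @Metric.hausdorffEDist_le_of_mem_edist _ (mkMetric _) _ _ _ (fun ω _ => ?_)
      fun φ _ => ⟨φ, Set.mem_univ φ, (@edist_self _ (mkMetric _) φ).le.trans zero_le⟩
    obtain ⟨Ω, hΩ⟩ := exists_state_comp_eq ρ hρ ω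
    refine ⟨_, ⟨dualMap (πB.prod πB) Ω, rfl⟩, mkDist_le_iff.2 fun x hx => ?_⟩
    have h1 : ω.1 (x : A × B) - Ω.1 (πB (x : A × B).2, πB (x : A × B).2)
        = Ω.1 (πA (x : A × B).1 - πB (x : A × B).2, 0) := by
      rw [← hΩ, ← map_sub]
      congr 1
      exact Prod.ext rfl (sub_self _)
    change ‖ω.1 (x : A × B) - Ω.1 (πB (x : A × B).2, πB (x : A × B).2)‖ₑ ≤ r
    rw [h1]
    refine (hstate _ _).trans ?_
    rw [hleft]
    exact hdist hx

end Glue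

/-! ### Separable Hilbert spaces and Hilbert sums of representations. -/

section Hilbert

open scoped InnerProductSpace

/-- Orthonormal vectors are `√2` apart, so balls of radius `1/2` around them are disjoint. -/
lemma Orthonormal.countable_of_separableSpace {H : Type*} [NormedAddCommGroup H]
    [InnerProductSpace ℂ H] [TopologicalSpace.SeparableSpace H] {w : Set H}
    (hw : Orthonormal ℂ ((↑) : w → H)) : w.Countable := by
  refine Set.PairwiseDisjoint.countable_of_isOpen (s := fun x => Metric.ball x (1 / 2)) ?_
    (fun _ _ => Metric.isOpen_ball) fun _ _ => Metric.nonempty_ball.2 (by norm_num)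
  intro x hx y hy hxy
  refine Metric.ball_disjoint_ball ?_
  have h0 : ⟪x, y⟫_ℂ = 0 := hw.2 (i := ⟨x, hx⟩) (j := ⟨y, hy⟩) fun h => hxy (congrArg Subtype.val h)
  have h1 : ‖x‖ = 1 := hw.1 ⟨x, hx⟩
  have h2 : ‖y‖ = 1 := hw.1 ⟨y, hy⟩
  have h3 := norm_sub_sq (𝕜 := ℂ) x y
  rw [h0, h1, h2] at h3
  simp at h3
  rw [dist_eq_norm]
  nlinarith [norm_nonneg (x - y)]

lemma exists_hilbertBasis_nat (H : Type*) [NormedAddCommGroup H] [InnerProductSpace ℂ H]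
    [CompleteSpace H] [TopologicalSpace.SeparableSpace H] (hH : ¬ FiniteDimensional ℂ H) :
    Nonempty (HilbertBasis ℕ ℂ H) := by
  obtain ⟨w, b, hb⟩ := exists_hilbertBasis ℂ H
  have hc : w.Countable := Orthonormal.countable_of_separableSpace (hb ▸ b.orthonormal)
  have hi : Infinite w := by
    by_contra hfin
    rw [not_infinite_iff_finite] at hfin
    have := Fintype.ofFinite w
    exact hH b.toOrthonormalBasis.toBasis.finiteDimensional_of_finite
  have := hc.to_subtype
  have := Encodable.ofCountable w
  obtain ⟨d⟩ := nonempty_denumerable w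
  let e : ℕ ≃ w := (Denumerable.eqv w).symm
  refine ⟨HilbertBasis.mk (b.orthonormal.comp e e.injective) ?_⟩
  rw [e.surjective.range_comp, b.dense_span]

lemma nonempty_linearIsometryEquiv (H K : Type*) [NormedAddCommGroup H] [InnerProductSpace ℂ H]
    [CompleteSpace H] [TopologicalSpace.SeparableSpace H] [NormedAddCommGroup K]
    [InnerProductSpace ℂ K] [CompleteSpace K] [TopologicalSpace.SeparableSpace K]
    (hH : ¬ FiniteDimensional ℂ H) (hK : ¬ FiniteDimensional ℂ K) : Nonempty (H ≃ₗᵢ[ℂ] K) := by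
  obtain ⟨b⟩ := exists_hilbertBasis_nat H hH
  obtain ⟨c⟩ := exists_hilbertBasis_nat K hK
  exact ⟨b.repr.trans c.repr.symm⟩

section DirectSum

variable {ι : Type*} {G : ι → Type*} [∀ i, NormedAddCommGroup (G i)]
  [∀ i, InnerProductSpace ℂ (G i)]

lemma separableSpace_lp [Countable ι] [∀ i, TopologicalSpace.SeparableSpace (G i)] :
    TopologicalSpace.SeparableSpace (lp G 2) := by
  classical
  rw [← TopologicalSpace.isSeparable_univ_iff]
  let S : Set (lp G 2) := ⋃ i, Set.range (lp.single 2 i)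
  have hS : TopologicalSpace.IsSeparable S :=
    TopologicalSpace.IsSeparable.iUnion fun i =>
      TopologicalSpace.isSeparable_range (lp.isometry_single i).continuous
  refine (hS.span (R := ℂ)).closure.mono fun x _ => ?_
  refine mem_closure_of_tendsto (lp.hasSum_single (by norm_num) x) (Filter.Eventually.of_forall ?_)
  intro s
  exact Submodule.sum_mem _ fun i _ =>
    Submodule.subset_span (Set.mem_iUnion.2 ⟨i, x i, rfl⟩)

lemma not_finiteDimensional_lp [Infinite ι] [∀ i, Nontrivial (G i)] :
    ¬ FiniteDimensional ℂ (lp G 2) := by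
  classical
  intro h
  choose v hv using fun i => exists_ne (0 : G i)
  have hli : LinearIndependent ℂ fun i => (lp.single 2 i (v i) : lp G 2) := by
    refine linearIndependent_of_ne_zero_of_inner_eq_zero (fun i hi => hv i ?_) fun i j hij => ?_
    · have := congrArg (fun f : lp G 2 => f i) hi
      simpa using this
    · beta_reduce
      rw [lp.inner_single_left, lp.single_apply_ne _ _ _ hij, inner_zero_right]
  exact Infinite.not_finite (α := ι) hli.finite

variable [∀ i, CompleteSpace (G i)] {A : Type*} [CStarAlgebra A]

/-- Domination by `‖a‖ • x` yields both square-summability and the operator bound of `lpOperator`.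
-/
lemma memℓp_starAlgHom_apply (π : ∀ i, A →⋆ₐ[ℂ] (G i →L[ℂ] G i)) (a : A) (x : lp G 2) (i : ι) :
    ‖π i a (x i)‖ ≤ ‖(((‖a‖ : ℂ) • x : lp G 2) : ∀ i, G i) i‖ := by
  rw [lp.coeFn_smul, Pi.smul_apply, norm_smul, Complex.norm_real, norm_norm]
  exact ((π i a).le_opNorm _).trans
    (mul_le_mul_of_nonneg_right (NonUnitalStarAlgHom.norm_apply_le (π i) a) (norm_nonneg _))

/-- The operator acting on a Hilbert sum of representations. -/
noncomputable def lpOperator (π : ∀ i, A →⋆ₐ[ℂ] (G i →L[ℂ] G i)) (a : A) :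
    lp G 2 →L[ℂ] lp G 2 :=
  LinearMap.mkContinuous
    { toFun := fun x => ⟨fun i => π i a (x i),
        (lp.memℓp ((‖a‖ : ℂ) • x : lp G 2)).mono' (memℓp_starAlgHom_apply π a x)⟩
      map_add' := fun x y => lp.ext (funext fun i => map_add (π i a) (x i) (y i))
      map_smul' := fun c x => lp.ext (funext fun i => map_smul (π i a) c (x i)) }
    ‖a‖ fun x => by
      refine (lp.norm_mono two_ne_zero (memℓp_starAlgHom_apply π a x)).trans_eq ?_
      rw [norm_smul, Complex.norm_real, norm_norm]

@[simp] lemma lpOperator_apply (π : ∀ i, A →⋆ₐ[ℂ] (G i →L[ℂ] G i)) (a : A) (x : lp G 2) (i : ι) :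
    lpOperator π a x i = π i a (x i) := rfl

/-- The Hilbert sum of a family of representations. -/
noncomputable def lpStarAlgHom (π : ∀ i, A →⋆ₐ[ℂ] (G i →L[ℂ] G i)) :
    A →⋆ₐ[ℂ] (lp G 2 →L[ℂ] lp G 2) where
  toFun := lpOperator π
  map_one' := by
    ext x i
    simp
  map_mul' a b := by
    ext x i
    simp
  map_zero' := by
    ext x i
    simp
  map_add' a b := by
    ext x i
    simp
  commutes' c := by
    ext x i
    simp [Algebra.algebraMap_eq_smul_one]
  map_star' a := by
    refine (ContinuousLinearMap.eq_adjoint_iff _ _).2 fun x y => ?_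
    rw [lp.inner_eq_tsum, lp.inner_eq_tsum]
    refine tsum_congr fun i => ?_
    rw [lpOperator_apply, lpOperator_apply, map_star, ContinuousLinearMap.star_eq_adjoint,
      ContinuousLinearMap.adjoint_inner_left]

lemma eq_zero_of_lpStarAlgHom_eq_zero {π : ∀ i, A →⋆ₐ[ℂ] (G i →L[ℂ] G i)} {a : A}
    (h : lpStarAlgHom π a = 0) (i : ι) : π i a = 0 := by
  classical
  ext v
  have h1 := congrArg (fun T : lp G 2 →L[ℂ] lp G 2 => T (lp.single 2 i v) i) h
  simpa [lpStarAlgHom] using h1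

end DirectSum

end Hilbert

/-! ### Separability and faithful representations on a given Hilbert space. -/

section Representations

attribute [local instance] CStarAlgebra.spectralOrder CStarAlgebra.spectralOrderedRing

variable {A : Type*} [CStarAlgebra A] {F : ℝ≥0 → ℝ≥0 → ℝ≥0 → ℝ≥0 → ℝ≥0} {L : PartialSeminorm A}

/-- After centering and rescaling, the domain lies in the real span of a totally bounded slice and
`1`; it is dense in the self-adjoint part. -/
lemma IsQuantumCompactMetricSpace.separableSpace [Nontrivial A]
    (hL : IsQuantumCompactMetricSpace F L) : TopologicalSpace.SeparableSpace A := by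
  obtain ⟨μ⟩ : Nonempty (StateSpace A) := inferInstance
  have hK := ((hL.totallyBounded μ).isSeparable.union
    (Set.countable_singleton (1 : selfAdjoint A)).isSeparable).span (R := ℝ)
  have hdom : (L.dom : Set (selfAdjoint A)) ⊆ Submodule.span ℝ
      ({a : selfAdjoint A | L a ≤ 1 ∧ μ.1 (a : A) = 0} ∪ {1}) := by
    intro a ha
    have ha' : L a < ∞ := ha
    set c : ℝ := (L a).toReal + 1
    have hc : 0 < c := by positivity
    have h1 : a = c • (c⁻¹ • center μ a) + (μ.1 (a : A)).re • 1 := by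
      rw [smul_inv_smul₀ hc.ne']
      exact (sub_add_cancel _ _).symm
    rw [h1]
    refine Submodule.add_mem _ (Submodule.smul_mem _ _ (Submodule.subset_span (Or.inl ⟨?_, ?_⟩)))
      (Submodule.smul_mem _ _ (Submodule.subset_span (Or.inr rfl)))
    · rw [L.smul', Real.enorm_of_nonneg (inv_nonneg.2 hc.le), ENNReal.ofReal_inv_of_pos hc,
        mul_comm, ← div_eq_mul_inv]
      refine ENNReal.div_le_of_le_mul ((apply_center_le hL.apply_one μ a).trans ?_)
      rw [one_mul, ENNReal.le_ofReal_iff_toReal_le ha'.ne hc.le]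
      exact le_add_of_nonneg_right zero_le_one
    · have h2 : ((c⁻¹ • center μ a : selfAdjoint A) : A) = c⁻¹ • (center μ a : A) := rfl
      rw [h2, μ.apply_real_smul, apply_center, sub_self, mul_zero]
  have hsep : TopologicalSpace.SeparableSpace (selfAdjoint A) := by
    rw [← TopologicalSpace.isSeparable_univ_iff, ← hL.dense_dom.closure_eq]
    exact (hK.mono hdom).closure
  have hs : Function.Surjective fun p : selfAdjoint A × selfAdjoint A =>
      (p.1 : A) + Complex.I • (p.2 : A) :=
    fun a => ⟨(realPart a, imaginaryPart a), realPart_add_I_smul_imaginaryPart a⟩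
  exact hs.denseRange.separableSpace (by fun_prop)

lemma separableSpace_of_compactSpace {X : Type*} [t : TopologicalSpace X] [CompactSpace X]
    (m : PseudoEMetricSpace X) (h : m.toUniformSpace.toTopologicalSpace = t) :
    TopologicalSpace.SeparableSpace X := by
  subst h
  have := EMetric.secondCountable_of_sigmaCompact X
  infer_instance

/-- The state space is compact and metrizable, hence separable; a dense sequence of states detects
`star a * a`, whose norm is `‖a‖²`. -/
lemma IsQuantumCompactMetricSpace.exists_faithful_seq [Nontrivial A]
    (hL : IsQuantumCompactMetricSpace F L) :
    ∃ φ : ℕ → StateSpace A, ∀ a : A, (∀ n, (φ n).1 (star a * a) = 0) → a = 0 := by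
  have := separableSpace_of_compactSpace (mkMetric L) hL.mk_topology
  refine ⟨TopologicalSpace.denseSeq (StateSpace A), fun a ha => ?_⟩
  have hcl : IsClosed {φ : StateSpace A | φ.1 (star a * a) = 0} :=
    isClosed_eq (StateSpace.continuous_eval _) continuous_const
  have hall (φ : StateSpace A) : φ.1 (star a * a) = 0 :=
    hcl.closure_subset_iff.2 (Set.range_subset_iff.2 ha)
      (TopologicalSpace.denseRange_denseSeq (StateSpace A) φ)
  have h := norm_le_of_forall_state (IsSelfAdjoint.star_mul_self a) le_rfl
    fun φ => (by rw [hall φ, norm_zero])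
  rw [CStarRing.norm_star_mul_self] at h
  exact norm_eq_zero.1 (by nlinarith [norm_nonneg a])

lemma StateSpace.norm_toPreGNS_sq (φ : StateSpace A) (a : A) :
    ‖φ.toPositive.toPreGNS a‖ ^ 2 = (φ.1 (star a * a)).re := by
  have h := φ.toPositive.preGNS_norm_sq (φ.toPositive.toPreGNS a)
  rw [PositiveLinearMap.ofPreGNS_toPreGNS, StateSpace.toPositive_apply] at h
  rw [← h, ← Complex.ofReal_pow, Complex.ofReal_re]

lemma StateSpace.separableSpace_GNS [TopologicalSpace.SeparableSpace A] (φ : StateSpace A) :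
    TopologicalSpace.SeparableSpace φ.toPositive.GNS := by
  have hc : Continuous φ.toPositive.toPreGNS := by
    refine AddMonoidHomClass.continuous_of_bound φ.toPositive.toPreGNS 1 fun a => ?_
    rw [one_mul]
    refine abs_le_of_sq_le_sq' ?_ (norm_nonneg _) |>.2
    rw [φ.norm_toPreGNS_sq, sq, ← CStarRing.norm_star_mul_self]
    exact (Complex.re_le_norm _).trans (φ.norm_apply_le _)
  have : TopologicalSpace.SeparableSpace φ.toPositive.PreGNS :=
    φ.toPositive.toPreGNS.surjective.denseRange.separableSpace hc
  infer_instance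

/-- Nonzero summands make the Hilbert sum infinite-dimensional even if `A` is finite-dimensional. -/
lemma StateSpace.nontrivial_GNS (φ : StateSpace A) : Nontrivial φ.toPositive.GNS := by
  refine ⟨(φ.toPositive.toPreGNS 1 : φ.toPositive.GNS), 0, fun h => ?_⟩
  have h1 := φ.norm_toPreGNS_sq 1
  rw [← UniformSpace.Completion.norm_coe, h, star_one, one_mul, φ.map_one] at h1
  simp at h1

/-- Evaluation at the cyclic vector: the operator of `a` sends the class of `1` to that of `a`,
whose squared norm is `φ(star a * a)`. -/
lemma StateSpace.apply_star_mul_self_eq_zero (φ : StateSpace A) {a : A}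
    (h : φ.toPositive.gnsStarAlgHom a = 0) : φ.1 (star a * a) = 0 := by
  have h1 : φ.toPositive.gnsNonUnitalStarAlgHom a = 0 := h
  have h2 := congrArg (fun T => T (φ.toPositive.toPreGNS 1 : φ.toPositive.GNS)) h1
  have h3 : φ.toPositive.leftMulMapPreGNS a (φ.toPositive.toPreGNS 1)
      = φ.toPositive.toPreGNS a := by
    simp
  simp only [PositiveLinearMap.gnsNonUnitalStarAlgHom_apply_coe, h3] at h2
  have h4 := φ.toPositive.preGNS_norm_sq (φ.toPositive.toPreGNS a)
  rw [← UniformSpace.Completion.norm_coe, h2] at h4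
  simpa using h4.symm

theorem IsQuantumCompactMetricSpace.exists_injective_representation [Nontrivial A]
    (hL : IsQuantumCompactMetricSpace F L) (H : Type*) [NormedAddCommGroup H]
    [InnerProductSpace ℂ H] [CompleteSpace H] [TopologicalSpace.SeparableSpace H]
    (hH : ¬ FiniteDimensional ℂ H) :
    ∃ π : A →⋆ₐ[ℂ] (H →L[ℂ] H), Function.Injective π := by
  have := hL.separableSpace
  obtain ⟨φ, hφ⟩ := hL.exists_faithful_seq
  have (n : ℕ) := (φ n).separableSpace_GNS
  have (n : ℕ) := (φ n).nontrivial_GNS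
  let G : ℕ → Type _ := fun n => (φ n).toPositive.GNS
  have := separableSpace_lp (G := G)
  obtain ⟨e⟩ := nonempty_linearIsometryEquiv (lp G 2) H not_finiteDimensional_lp hH
  let π := lpStarAlgHom (G := G) fun n => (φ n).toPositive.gnsStarAlgHom
  refine ⟨(e.conjStarAlgEquiv : (lp G 2 →L[ℂ] lp G 2) →⋆ₐ[ℂ] (H →L[ℂ] H)).comp π, ?_⟩
  refine e.conjStarAlgEquiv.injective.comp ((injective_iff_map_eq_zero π).2 fun a ha => ?_)
  exact hφ a fun n => (φ n).apply_star_mul_self_eq_zero (eq_zero_of_lpStarAlgHom_eq_zero ha n)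

end Representations

end QuantumMetric

theorem mainTheorem8 {A : Type u} {B : Type v} [CStarAlgebra A] [CStarAlgebra B]
    [Nontrivial A] [Nontrivial B]
    (F : ℝ≥0 → ℝ≥0 → ℝ≥0 → ℝ≥0 → ℝ≥0) (hF : IsPermissible F)
    (LA : PartialSeminorm A) (LB : PartialSeminorm B)
    (hA : IsQuantumCompactMetricSpace F LA) (hB : IsQuantumCompactMetricSpace F LB)
    (D : ℝ≥0∞) (hD : D = max (stateDiam LA) (stateDiam LB)) :
    D < ∞ ∧
    (∀ ε : ℝ≥0, 0 < D + ε →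
      ∃ (E : Type (max u v)) (_ : CStarAlgebra E) (L : PartialSeminorm E)
        (π₁ : E →⋆ₐ[ℂ] A) (π₂ : E →⋆ₐ[ℂ] B),
        IsTunnel F LA LB L π₁ π₂ ∧ extent L π₁ π₂ ≤ D + ε) ∧
    (∀ (H : Type w) [NormedAddCommGroup H] [InnerProductSpace ℂ H] [CompleteSpace H]
      [TopologicalSpace.SeparableSpace H], ¬ FiniteDimensional ℂ H →
      (∃ πA : A →⋆ₐ[ℂ] (H →L[ℂ] H), Function.Injective πA) ∧
      (∃ πB : B →⋆ₐ[ℂ] (H →L[ℂ] H), Function.Injective πB) ∧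
      ∀ (πA : A →⋆ₐ[ℂ] (H →L[ℂ] H)) (πB : B →⋆ₐ[ℂ] (H →L[ℂ] H)),
        Function.Injective πA → Function.Injective πB → ∀ ε : ℝ≥0, 0 < D + ε →
          IsTunnel F LA LB (glue LA LB πA πB (D + ε))
            (StarAlgHom.fst ℂ A B) (StarAlgHom.snd ℂ A B) ∧
          extent (glue LA LB πA πB (D + ε))
            (StarAlgHom.fst ℂ A B) (StarAlgHom.snd ℂ A B) ≤ D + ε) := by
  have hfin : D < ∞ := hD ▸ max_lt hA.stateDiam_lt_top hB.stateDiam_lt_top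
  have hDA : stateDiam LA ≤ D := hD ▸ le_max_left _ _
  have hDB : stateDiam LB ≤ D := hD ▸ le_max_right _ _
  have hr' (ε : ℝ≥0) : D + ε ≠ ∞ := ENNReal.add_ne_top.2 ⟨hfin.ne, ENNReal.coe_ne_top⟩
  refine ⟨hfin, fun ε hε => ?_, fun H _ _ _ _ hH => ⟨hA.exists_injective_representation H hH,
    hB.exists_injective_representation H hH, fun πA πB hπA hπB ε hε => ⟨?_, ?_⟩⟩⟩
  -- The bare existence claim needs some Hilbert space; `ℓ²(ℕ)` serves.
  · have := separableSpace_lp (G := fun _ : ℕ => ℂ)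
    have hH := not_finiteDimensional_lp (G := fun _ : ℕ => ℂ)
    obtain ⟨πA, hπA⟩ := hA.exists_injective_representation _ hH
    obtain ⟨πB, hπB⟩ := hB.exists_injective_representation _ hH
    exact ⟨A × B, inferInstance, glue LA LB πA πB (D + ε), StarAlgHom.fst ℂ A B,
      StarAlgHom.snd ℂ A B, glue_isTunnel hF hA hB hπB hε.ne' (hr' ε)
        (hDA.trans le_self_add) (hDB.trans le_self_add), glue_extent_le hπA hπB hε.ne' (hr' ε)⟩
  · exact glue_isTunnel hF hA hB hπB hε.ne' (hr' ε) (hDA.trans le_self_add)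
      (hDB.trans le_self_add)
  · exact glue_extent_le hπA hπB hε.ne' (hr' ε)
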